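/- **Setting.** A system of edge weights on the full graph $\mathcal G$ with vertices $1,\dots,n$ is a real symmetric matrix $w=(w_{ij})$ with $w_{ij}\ge 0$ and $w_{ii}=0$. For two such systems $w,\tilde w$ let $\hat{\mathcal G}^{w,\tilde w}$ be the graph with $2n$ vertices and matrix of edge weights $$m=\begin{pmatrix}0&(w_+)^{\top}\\ w_+&\min(w,\tilde w)\end{pmatrix},$$ where $w_+$ is obtained from $w$ by replacing the entries strictly below the diagonal by $+\infty$ and the minimum is taken entrywise. For $\alpha\in\mathbb R$, the Vietoris–Rips complex $\mathrm{VR}_\alpha(\hat{\mathcal G}^{w,\tilde w})$ consists of the sets $\sigma$ of vertices with $m_{ab}\le\alpha$ for all $a,b\in\sigma$. For an integer $k\ge 0$, $\text{R-Cross-Barcode}_k(w,\tilde w)$ is the $k$-th persistence barcode, with coefficients in $\mathbb Z/2$, of the filtration $(\mathrm{VR}_\alpha(\hat{\mathcal G}^{w,\tilde w}))_{\alpha\in\mathbb R}$, where reduced homology is used if $k=0$: it is the multiset of intervals $[b,d)$, $b<d\le\infty$, between the births and deaths of the basic $k$-dimensional homology classes. The bottleneck distance $d_B$ of two barcodes is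 the infimum of the $\delta\ge 0$ for which there is a partial matching of their intervals such that matched intervals have births and deaths differing by at most $\delta$ and unmatched intervals have length at most $2\delta$. The bottleneck norm is $\lVert B\rVert_B=d_B(B,\varnothing)$. For a measurable space $\mathcal X$ with a probability measure $\mu$ and two metrics $u,u'$ on $\mathcal X$, set $$GW(u,u')=\inf_{(Z,\rho),\,e,\,e'}\int_{\mathcal X}\rho(e(x),e'(x))\,d\mu(x)\in[0,\infty],$$ the infimum over all metric spaces $(Z,\rho)$ and all maps $e,e':\mathcal X\to Z$ that are isometric embeddings of $(\mathcal X,u)$ and $(\mathcal X,u')$ respectively and for which the integrand is $\mu$-measurable. **Proposition.** Let $k,n\ge 0$ be integers. (a) For all edge weights $w,\tilde w,v,\tilde v$ on $\mathcal G$, $$d_B\big(\text{R-Cross-Barcode}_k(w,\tilde w),\text{R-Cross-Barcode}_k(v,\tilde v)\big)\le\max\Big(\max_{ij}|v_{ij}-w_{ij}|,\ \max_{ij}|\tilde v_{ij}-\tilde w_{ij}|\Big).$$ (b) For all edge weights $w,\tilde w$ on $\mathcal G$, $$\big\lVert\text{R-Cross-Barcode}_k(w,\tilde w)\big\rVert_B\le\max_{ij}|w_{ij}-\tilde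 w_{ij}|.$$ (For $n=0$ the maxima over the empty set are read as $0$.) (c) Let $u,u',\tilde u$ be metrics on a probability space $(\mathcal X,\mu)$ that are measurable as functions on $\mathcal X\times\mathcal X$, and for $x_1,\dots,x_n\in\mathcal X$ put $w_{ij}=u(x_i,x_j)$, $w'_{ij}=u'(x_i,x_j)$, $\tilde w_{ij}=\tilde u(x_i,x_j)$. Then the integrand below is a measurable function of $(x_1,\dots,x_n)$ and $$\int_{\mathcal X^n}d_B\big(\text{R-Cross-Barcode}_k(w,\tilde w),\text{R-Cross-Barcode}_k(w',\tilde w)\big)\,d\mu^{\otimes n}\le n\,GW(u,u').$$ (d) Let $u,\tilde u$ be metrics on a probability space $(\mathcal X,\mu)$ that are measurable as functions on $\mathcal X\times\mathcal X$, and put $w_{ij}=u(x_i,x_j)$, $\tilde w_{ij}=\tilde u(x_i,x_j)$. Then the integrand below is a measurable function of $(x_1,\dots,x_n)$ and $$\int_{\mathcal X^n}\big\lVert\text{R-Cross-Barcode}_k(w,\tilde w)\big\rVert_B\,d\mu^{\otimes n}\le n\,GW(u,\tilde u).$$ -/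

import Mathlib

open scoped ENNReal NNReal
open MeasureTheory

universe u

noncomputable section

/-! ### Filtered simplicial complexes and their persistent homology modulo 2 -/

/-- A nested family, indexed by real thresholds, of simplicial complexes on the vertex set `V`.
Simplices are arbitrary finite subsets of `V`, of dimension `card - 1`; in particular the empty set
is a simplex, of dimension `-1`. -/
structure FilteredComplex (V : Type*) where
  /-- the simplices present at a given threshold -/
  faces : ℝ → Set (Finset V)
  /-- each level contains the faces of its simplices -/
  down_closed : ∀ α σ τ, σ ∈ faces α → τ ⊆ σ → τ ∈ faces α
  /-- the levels are nested -/
  mono : Monotone faces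

/-- The boundary operator modulo 2, on the formal combinations (given by their coefficients) of the
subsets of the finite set `V`: a simplex is sent to the sum of its facets. -/
def boundary (V : Type*) [Fintype V] [DecidableEq V] :
    (Finset V → ZMod 2) →ₗ[ZMod 2] (Finset V → ZMod 2) :=
  Fintype.linearCombination (ZMod 2) fun σ : Finset V => ∑ v ∈ σ, Pi.single (σ.erase v) 1

namespace FilteredComplex

/-- `C_k` at threshold `α`: combinations modulo 2 of the `k`-dimensional simplices. -/
def chains {V : Type*} (K : FilteredComplex V) (k : ℕ) (α : ℝ) :
    Submodule (ZMod 2) (Finset V → ZMod 2) where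
  carrier := {c | ∀ σ, c σ ≠ 0 → σ ∈ K.faces α ∧ σ.card = k + 1}
  zero_mem' := fun _ h => absurd rfl h
  add_mem' := fun {c e} hc he σ h => by
    by_cases h0 : c σ = 0
    · exact he σ fun h1 => h (by simp [h0, h1])
    · exact hc σ h0
  smul_mem' := fun a c hc σ h => hc σ fun h0 => h (by simp [h0])

theorem chains_mono {V : Type*} (K : FilteredComplex V) (k : ℕ) {s t : ℝ} (h : s ≤ t) :
    K.chains k s ≤ K.chains k t :=
  fun _ hc σ hσ => ⟨K.mono h (hc σ hσ).1, (hc σ hσ).2⟩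

variable {V : Type*} [Fintype V] [DecidableEq V] (K : FilteredComplex V)

/-- The `k`-cycles at threshold `α`. As the boundary of a vertex is the empty simplex, the
`0`-cycles are the combinations of an even number of vertices. -/
def cycles (k : ℕ) (α : ℝ) : Submodule (ZMod 2) (Finset V → ZMod 2) :=
  K.chains k α ⊓ LinearMap.ker (boundary V)

/-- The `k`-boundaries at threshold `α`. -/
def boundaries (k : ℕ) (α : ℝ) : Submodule (ZMod 2) (Finset V → ZMod 2) :=
  (K.chains (k + 1) α).map (boundary V)

theorem cycles_mono (k : ℕ) {s t : ℝ} (h : s ≤ t) : K.cycles k s ≤ K.cycles k t :=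
  inf_le_inf_right _ (K.chains_mono k h)

theorem boundaries_mono (k : ℕ) {s t : ℝ} (h : s ≤ t) : K.boundaries k s ≤ K.boundaries k t :=
  Submodule.map_mono (K.chains_mono (k + 1) h)

/-- The homology `H_k` at threshold `α`, cycles modulo boundaries. It is the usual homology modulo 2
for `k ≥ 1` and the reduced homology for `k = 0`. -/
abbrev Homology (k : ℕ) (α : ℝ) : Type _ :=
  K.cycles k α ⧸ (K.boundaries k α).submoduleOf (K.cycles k α)

/-- The map on homology induced by the inclusion of the complex at threshold `s` into the one
at threshold `t`. -/
def homologyMap (k : ℕ) {s t : ℝ} (h : s ≤ t) : K.Homology k s →ₗ[ZMod 2] K.Homology k t :=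
  Submodule.mapQ _ _ (Submodule.inclusion (K.cycles_mono k h))
    fun _ hx => K.boundaries_mono k h hx

/-- The classes at threshold `b` that already come from a threshold smaller than `b`. -/
def bornBefore (k : ℕ) (b : ℝ) : Submodule (ZMod 2) (K.Homology k b) :=
  ⨆ (s : ℝ) (h : s < b), LinearMap.range (K.homologyMap k h.le)

/-- The classes at threshold `b` that are zero at every threshold `t ≥ d`
(no condition if `d = ∞`). -/
def deadAt (k : ℕ) (b : ℝ) (d : EReal) : Submodule (ZMod 2) (K.Homology k b) :=
  ⨅ (t : ℝ) (h : b ≤ t) (_ : d ≤ (t : EReal)), LinearMap.ker (K.homologyMap k h)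

/-- The classes at threshold `b` that are already zero at some threshold `t < d`. -/
def deadBefore (k : ℕ) (b : ℝ) (d : EReal) : Submodule (ZMod 2) (K.Homology k b) :=
  ⨆ (t : ℝ) (h : b ≤ t) (_ : (t : EReal) < d), LinearMap.ker (K.homologyMap k h)

end FilteredComplex

/-! ### Barcodes and the bottleneck distance -/

/-- A barcode is a multiset of intervals `[b, d)`, given by the multiplicity of each pair `(b, d)`;
the value `d = ∞` is allowed. -/
abbrev Barcode : Type := ℝ × EReal → ℕ

/-- The `k`-th persistence barcode: the multiplicity of `[b, d)` is the number of independent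
`k`-dimensional homology classes that are born exactly at `b` and die exactly at `d`, that is,
the dimension of the space of classes at `b` dead at `d`, modulo those born before `b` and those
dead before `d`. This is the number of summands `[b, d)` in the decomposition of the
persistence module into interval modules; it is `0` unless `b < d`. -/
def FilteredComplex.barcode {V : Type*} [Fintype V] [DecidableEq V] (K : FilteredComplex V) (k : ℕ) :
    Barcode := fun p =>
  Module.finrank (ZMod 2)
    (K.deadAt k p.1 p.2 ⧸
      (K.bornBefore k p.1 ⊔ K.deadBefore k p.1 p.2).submoduleOf (K.deadAt k p.1 p.2))

namespace Barcode

/-- The bars of a barcode, each repeated according to its multiplicity. -/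
abbrev Bar (B : Barcode) : Type := Σ p : ℝ × EReal, Fin (B p)

/-- Two intervals are within `δ` in the sup distance of their end points. -/
def Close (δ : ℝ≥0) (p q : ℝ × EReal) : Prop :=
  |p.1 - q.1| ≤ δ ∧ p.2 ≤ q.2 + ((δ : ℝ) : EReal) ∧ q.2 ≤ p.2 + ((δ : ℝ) : EReal)

/-- An interval is within `δ` of the diagonal: its length is at most `2 δ`. -/
def Short (δ : ℝ≥0) (p : ℝ × EReal) : Prop :=
  p.2 ≤ ((p.1 + 2 * δ : ℝ) : EReal)

/-- There is a partial matching of the bars of `B` with the bars of `C` in which matched bars are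
within `δ` of each other and unmatched bars are within `δ` of the diagonal. -/
def Matched (δ : ℝ≥0) (B C : Barcode) : Prop :=
  ∃ f : B.Bar ≃. C.Bar,
    (∀ x y, f x = some y → Close δ x.1 y.1) ∧
    (∀ x, f x = none → Short δ x.1) ∧
    (∀ y, f.symm y = none → Short δ y.1)

/-- The bottleneck distance. -/
def bottleneckDist (B C : Barcode) : ℝ≥0∞ :=
  ⨅ (δ : ℝ≥0) (_ : Matched δ B C), (δ : ℝ≥0∞)

/-- The bottleneck norm: the bottleneck distance to the empty barcode. -/
def bottleneckNorm (B : Barcode) : ℝ≥0∞ :=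
  bottleneckDist B 0

end Barcode

/-! ### Weighted graphs and the R-Cross-Barcode -/

/-- The Vietoris-Rips filtration of the graph on `V` with edge weights `m i j`: a simplex is present
at threshold `α` when the weights between its vertices are at most `α`. -/
def vietorisRips {V : Type*} (m : V → V → EReal) : FilteredComplex V where
  faces α := {σ | ∀ i ∈ σ, ∀ j ∈ σ, m i j ≤ (α : EReal)}
  down_closed _ _ _ hσ hτ := fun i hi j hj => hσ i (hτ hi) j (hτ hj)
  mono _ _ h _ hσ := fun i hi j hj => (hσ i hi j hj).trans (EReal.coe_le_coe_iff.2 h)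

/-- Edge weights on the full graph with `n` vertices: a symmetric and non-negative matrix, with
`0` on the diagonal. -/
@[ext]
structure EdgeWeights (n : ℕ) where
  /-- the weight of the edge between two vertices -/
  weight : Fin n → Fin n → ℝ
  symm : ∀ i j, weight i j = weight j i
  nonneg : ∀ i j, 0 ≤ weight i j
  diag : ∀ i, weight i i = 0

/-- The matrix `m = (0, (w₊)ᵀ; w₊, min (w, w'))` of edge weights of the doubled graph, where `w₊` is
the matrix `w` with the entries strictly below the diagonal replaced by `+∞`. The vertices of the
first block are the `Sum.inl i`, those of the second the `Sum.inr i`. -/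
def crossMatrix {n : ℕ} (w w' : EdgeWeights n) : Fin n ⊕ Fin n → Fin n ⊕ Fin n → EReal
  | .inl _, .inl _ => 0
  | .inl j, .inr i => if i ≤ j then (w.weight i j : EReal) else ⊤
  | .inr i, .inl j => if i ≤ j then (w.weight i j : EReal) else ⊤
  | .inr i, .inr j => ((min (w.weight i j) (w'.weight i j) : ℝ) : EReal)

/-- The R-Cross-Barcode in degree `k` of a pair of edge weights on the same vertex set. -/
def rCrossBarcode {n : ℕ} (k : ℕ) (w w' : EdgeWeights n) : Barcode :=
  (vietorisRips (crossMatrix w w')).barcode k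

/-! ### Metrics on a measure space -/

/-- The edge weights `u (x i) (x j)` given by a metric `u` and points `x 1, …, x n`. -/
def sampleWeights {X : Type*} (u : MetricSpace X) {n : ℕ} (x : Fin n → X) : EdgeWeights n where
  weight i j := u.dist (x i) (x j)
  symm i j := u.dist_comm (x i) (x j)
  nonneg i j := @dist_nonneg X u.toPseudoMetricSpace (x i) (x j)
  diag i := u.dist_self (x i)

/-- The Gromov-Wasserstein type distance between two metrics `u`, `u'` on a measure space `(X, μ)`:
the infimum of `∫ ρ (e x, e' x) dμ` over all metric spaces `(Z, ρ)` and all maps `e, e' : X → Z`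
isometric with respect to `u` and `u'` for which the integrand is measurable. -/
def gromovWasserstein {X : Type u} [MeasurableSpace X] (μ : Measure X) (u u' : MetricSpace X) :
    ℝ≥0∞ :=
  sInf {r : ℝ≥0∞ | ∃ (Z : Type u) (ρ : MetricSpace Z) (e e' : X → Z),
    (∀ x y, ρ.dist (e x) (e y) = u.dist x y) ∧
    (∀ x y, ρ.dist (e' x) (e' y) = u'.dist x y) ∧
    AEMeasurable (fun x => ρ.dist (e x) (e' x)) μ ∧
    r = ∫⁻ x, ENNReal.ofReal (ρ.dist (e x) (e' x)) ∂μ}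

end

/-! The proposition rests on two facts: the barcode is 1-Lipschitz in the edge weights, and it is
empty when the two weights coincide.

Stability is proved by interpolation. The entries `⊤` of `crossMatrix` sit at fixed positions, so
all the Vietoris-Rips filtrations filter one complex by a function, the largest weight in a simplex,
which is 1-Lipschitz in the weights. Along the segment `(1 - t) f + t g`, strict inequalities
between values persist for parameters near a given one. The nearby filtrations therefore refine the
one at that parameter, and their barcodes map to its barcode by merging end points
(`IsSublevel.matched_of_coarser`). This gives a local Lipschitz bound, which the triangle inequality
makes global (`IsSublevel.bottleneckDist_le`). The merging claim holds because a multiplicity is a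
mixed second difference of dimensions of spaces of cycles, and such differences telescope.

For equal weights, the second copies of the vertices can be removed from the last to the first, each
being dominated by its first copy; what remains is a full simplex (`rCrossBarcode_self`). Thus the
norm of the barcode of `(w, w')` is its distance to the barcode of `(w, w)`, and (b) follows from
(a).

For (c) and (d), isometric embeddings in a common space bound each `|d (x i) (x j) - d' (x i) (x
j)|` by the sum over the sample of the displacements. Each of the `n` terms has the same integral.
-/

noncomputable section

/-! ### Multiplicities of intervals as dimension counts. -/

namespace FilteredComplex

variable {V : Type*} [Fintype V] [DecidableEq V] (K : FilteredComplex V)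

theorem homologyMap_mk_eq_zero_iff (k : ℕ) {s t : ℝ} (h : s ≤ t) (x : K.cycles k s) :
    K.homologyMap k h (Submodule.Quotient.mk x) = 0 ↔ (x : Finset V → ZMod 2) ∈ K.boundaries k t := by
  have h1 : K.homologyMap k h (Submodule.Quotient.mk x) =
    Submodule.Quotient.mk (Submodule.inclusion (K.cycles_mono k h) x) := rfl
  rw [h1, Submodule.Quotient.mk_eq_zero]
  rfl

theorem finrank_comap_mkQ {E : Type*} [AddCommGroup E] [Module (ZMod 2) E]
    [FiniteDimensional (ZMod 2) E] (N : Submodule (ZMod 2) E) (P : Submodule (ZMod 2) (E ⧸ N)) :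
    Module.finrank (ZMod 2) (P.comap N.mkQ) =
      Module.finrank (ZMod 2) P + Module.finrank (ZMod 2) N := by
  rw [← LinearMap.finrank_range_add_finrank_ker (N.mkQ.domRestrict (P.comap N.mkQ)),
    LinearMap.range_domRestrict, Submodule.map_comap_eq_of_surjective N.mkQ_surjective,
    ← Submodule.finrank_map_subtype_eq, LinearMap.ker_domRestrict,
    Submodule.map_comap_subtype, Submodule.ker_mkQ, inf_eq_right.2 (Submodule.le_comap_mkQ N P)]

/-- The cycles whose classes lie in a given space of homology classes. -/
def liftClasses (k : ℕ) (b : ℝ) (P : Submodule (ZMod 2) (K.Homology k b)) :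
    Submodule (ZMod 2) (Finset V → ZMod 2) :=
  (P.comap (Submodule.mkQ _)).map (K.cycles k b).subtype

theorem mem_liftClasses {k : ℕ} {b : ℝ} {P : Submodule (ZMod 2) (K.Homology k b)}
    {x : Finset V → ZMod 2} :
    x ∈ K.liftClasses k b P ↔
      ∃ hx : x ∈ K.cycles k b, (Submodule.Quotient.mk ⟨x, hx⟩ : K.Homology k b) ∈ P := by
  simp [liftClasses]

theorem finrank_liftClasses (k : ℕ) (b : ℝ) (P : Submodule (ZMod 2) (K.Homology k b)) :
    Module.finrank (ZMod 2) (K.liftClasses k b P) =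
      Module.finrank (ZMod 2) P +
        Module.finrank (ZMod 2) ((K.boundaries k b).submoduleOf (K.cycles k b)) := by
  rw [liftClasses, Submodule.finrank_map_subtype_eq]
  exact finrank_comap_mkQ _ _

theorem finrank_quotient_submoduleOf {E : Type*} [AddCommGroup E] [Module (ZMod 2) E]
    [FiniteDimensional (ZMod 2) E] (P Q : Submodule (ZMod 2) E) :
    Module.finrank (ZMod 2) (P ⧸ Q.submoduleOf P) +
      Module.finrank (ZMod 2) (Q ⊓ P : Submodule (ZMod 2) E) = Module.finrank (ZMod 2) P := by
  rw [← Submodule.finrank_quotient_add_finrank (Q.submoduleOf P)]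
  congr 1
  rw [Submodule.submoduleOf, ← Submodule.finrank_map_subtype_eq, Submodule.map_comap_subtype,
    inf_comm]

/-- Leaving `D` abstract treats finite and infinite deaths together: `D` is the space of boundaries
at `d` in the first case and `⊤` in the second. -/
theorem liftClasses_deadAt (k : ℕ) {b : ℝ} {d : EReal} {D : Submodule (ZMod 2) (Finset V → ZMod 2)}
    (hD : ∀ x, x ∈ D ↔ ∀ t : ℝ, b ≤ t → d ≤ (t : EReal) → x ∈ K.boundaries k t) :
    K.liftClasses k b (K.deadAt k b d) = K.cycles k b ⊓ D := by
  ext x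
  simp only [mem_liftClasses, deadAt, Submodule.mem_iInf, LinearMap.mem_ker,
    homologyMap_mk_eq_zero_iff, Submodule.mem_inf, hD, exists_prop]

/-- A finite complex does not change just before `b`, so a single threshold `s` can stand for the
supremum. `deadBefore_eq` does the same below `d`. -/
theorem bornBefore_eq (k : ℕ) {b s : ℝ} (hs : s < b)
    (hmax : ∀ s' < b, K.cycles k s' ≤ K.cycles k s) :
    K.bornBefore k b = LinearMap.range (K.homologyMap k hs.le) := by
  refine le_antisymm (iSup₂_le fun s' hs' => ?_) (le_iSup₂_of_le s hs le_rfl)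
  rintro _ ⟨x, rfl⟩
  induction x using Submodule.Quotient.induction_on with
  | _ x => exact ⟨Submodule.Quotient.mk ⟨x, hmax s' hs' x.2⟩, rfl⟩

theorem deadBefore_eq (k : ℕ) {b t : ℝ} {d : EReal} (hbt : b ≤ t) (htd : (t : EReal) < d)
    (hmax : ∀ t' : ℝ, b ≤ t' → (t' : EReal) < d → K.boundaries k t' ≤ K.boundaries k t) :
    K.deadBefore k b d = LinearMap.ker (K.homologyMap k hbt) := by
  refine le_antisymm (iSup_le fun t' => iSup₂_le fun h1 h2 => ?_)
    (le_iSup_of_le t (le_iSup₂_of_le hbt htd le_rfl))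
  intro x hx
  induction x using Submodule.Quotient.induction_on with
  | _ x =>
    rw [LinearMap.mem_ker, homologyMap_mk_eq_zero_iff] at *
    exact hmax t' h1 h2 hx

/-- If the class of `x` is the class of `y` plus `z`, then `x - y` itself represents `z`, so no
separate boundary term at `b` is needed. -/
theorem liftClasses_born_sup_dead (k : ℕ) {b s t : ℝ} (hs : s ≤ b) (ht : b ≤ t) :
    K.liftClasses k b (LinearMap.range (K.homologyMap k hs) ⊔ LinearMap.ker (K.homologyMap k ht)) =
      K.cycles k s ⊔ (K.cycles k b ⊓ K.boundaries k t) := by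
  ext x
  rw [mem_liftClasses, Submodule.mem_sup]
  simp only [Submodule.mem_sup]
  constructor
  · rintro ⟨hx, y, ⟨y', rfl⟩, z, hz, h⟩
    induction y' using Submodule.Quotient.induction_on with
    | _ y =>
    have hzmem : x - y ∈ K.cycles k b := sub_mem hx (K.cycles_mono k hs y.2)
    refine ⟨y, y.2, x - y, ⟨hzmem, ?_⟩, by abel⟩
    have : z = Submodule.Quotient.mk ⟨x - y, hzmem⟩ := by
      rw [eq_comm, ← sub_eq_iff_eq_add'] at h
      rw [← h]
      rfl
    rw [this, LinearMap.mem_ker, homologyMap_mk_eq_zero_iff] at hz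
    exact hz
  · rintro ⟨y, hy, z, ⟨hz, hz'⟩, rfl⟩
    refine ⟨add_mem (K.cycles_mono k hs hy) hz, Submodule.Quotient.mk ⟨y, K.cycles_mono k hs hy⟩,
      ⟨Submodule.Quotient.mk ⟨y, hy⟩, rfl⟩, Submodule.Quotient.mk ⟨z, hz⟩, ?_, rfl⟩
    rw [LinearMap.mem_ker, homologyMap_mk_eq_zero_iff]
    exact hz'

theorem liftClasses_inf (k : ℕ) (b : ℝ) (P Q : Submodule (ZMod 2) (K.Homology k b)) :
    K.liftClasses k b (P ⊓ Q) = K.liftClasses k b P ⊓ K.liftClasses k b Q := by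
  ext x
  simp only [mem_liftClasses, Submodule.mem_inf]
  tauto

/-- The multiplicity of an interval as an alternating sum of dimensions. -/
theorem barcode_add_finrank (k : ℕ) {b s t : ℝ} {d : EReal}
    {D : Submodule (ZMod 2) (Finset V → ZMod 2)} (hs : s < b)
    (hsmax : ∀ s' < b, K.cycles k s' ≤ K.cycles k s) (hbt : b ≤ t) (htd : (t : EReal) < d)
    (htmax : ∀ t' : ℝ, b ≤ t' → (t' : EReal) < d → K.boundaries k t' ≤ K.boundaries k t)
    (hD : ∀ x, x ∈ D ↔ ∀ t : ℝ, b ≤ t → d ≤ (t : EReal) → x ∈ K.boundaries k t) :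
    K.barcode k (b, d) +
        Module.finrank (ZMod 2) (K.cycles k s ⊓ D : Submodule _ _) +
        Module.finrank (ZMod 2) (K.cycles k b ⊓ K.boundaries k t : Submodule _ _) =
      Module.finrank (ZMod 2) (K.cycles k b ⊓ D : Submodule _ _) +
        Module.finrank (ZMod 2) (K.cycles k s ⊓ K.boundaries k t : Submodule _ _) := by
  have htD : K.boundaries k t ≤ D := fun x hx =>
    (hD x).2 fun t' _ h => K.boundaries_mono k
      (EReal.coe_le_coe_iff.1 (htd.le.trans h)) hx
  have hsb := K.cycles_mono k hs.le
  have h1 := finrank_quotient_submoduleOf (K.deadAt k b d) (K.bornBefore k b ⊔ K.deadBefore k b d)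
  have h2 := K.finrank_liftClasses k b (K.deadAt k b d)
  have h3 := K.finrank_liftClasses k b
    ((K.bornBefore k b ⊔ K.deadBefore k b d) ⊓ K.deadAt k b d)
  rw [liftClasses_inf, liftClasses_deadAt K k hD] at h3
  rw [liftClasses_deadAt K k hD] at h2
  rw [bornBefore_eq K k hs hsmax, deadBefore_eq K k hbt htd htmax,
    liftClasses_born_sup_dead] at h3
  -- This is the modular law, applicable because the boundaries at `t` lie in `D`.
  have h4 : (K.cycles k s ⊔ K.cycles k b ⊓ K.boundaries k t) ⊓ (K.cycles k b ⊓ D) =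
      K.cycles k s ⊓ D ⊔ K.cycles k b ⊓ K.boundaries k t := by
    rw [← inf_assoc, inf_eq_left.2 (sup_le hsb inf_le_left), sup_comm, sup_comm (_ ⊓ D),
      ← sup_inf_assoc_of_le]
    exact inf_le_right.trans htD
  have h5 := Submodule.finrank_sup_add_finrank_inf_eq (K.cycles k s ⊓ D)
    (K.cycles k b ⊓ K.boundaries k t)
  have h6 : (K.cycles k s ⊓ D) ⊓ (K.cycles k b ⊓ K.boundaries k t) =
      K.cycles k s ⊓ K.boundaries k t := by
    refine le_antisymm (le_inf (inf_le_left.trans inf_le_left) (inf_le_right.trans inf_le_right))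
      (le_inf (inf_le_inf_left _ htD) (inf_le_inf_right _ hsb))
  rw [h4] at h3
  rw [h6] at h5
  have h7 : K.barcode k (b, d) = Module.finrank (ZMod 2) (K.deadAt k b d ⧸
      (K.bornBefore k b ⊔ K.deadBefore k b d).submoduleOf (K.deadAt k b d)) := rfl
  rw [bornBefore_eq K k hs hsmax, deadBefore_eq K k hbt htd htmax] at h1 h7
  omega

theorem barcode_eq_zero_of_le (k : ℕ) {b : ℝ} {d : EReal} (h : d ≤ b) :
    K.barcode k (b, d) = 0 := by
  have h0 : K.deadAt k b d = ⊥ := by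
    rw [eq_bot_iff]
    intro x hx
    simp only [deadAt, Submodule.mem_iInf] at hx
    have := hx b le_rfl h
    induction x using Submodule.Quotient.induction_on with
    | _ x =>
      rw [LinearMap.mem_ker, homologyMap_mk_eq_zero_iff] at this
      rw [Submodule.mem_bot, Submodule.Quotient.mk_eq_zero]
      exact this
  have h1 := finrank_quotient_submoduleOf (K.deadAt k b d) (K.bornBefore k b ⊔ K.deadBefore k b d)
  rw [show K.barcode k (b, d) = Module.finrank (ZMod 2) (K.deadAt k b d ⧸
      (K.bornBefore k b ⊔ K.deadBefore k b d).submoduleOf (K.deadAt k b d)) from rfl]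
  rw [h0, finrank_bot] at *
  omega

theorem barcode_eq_zero_of_cycles_le (k : ℕ) (h : ∀ b, K.cycles k b ≤ K.boundaries k b) :
    K.barcode k = 0 := by
  funext p
  have : Subsingleton (K.Homology k p.1) := by
    rw [Submodule.Quotient.subsingleton_iff, Submodule.submoduleOf_eq_top]
    exact h p.1
  exact Module.finrank_zero_of_subsingleton

end FilteredComplex

end

/-! ### Barcodes of sublevel filtrations, and how they behave under coarsening. -/

noncomputable section

namespace FilteredComplex

section Telescoping

variable {ι : Type*} {M : Type*} [AddCommGroup M]

/-- The sum telescopes: `U` and `T` are closed downwards for `f`, so adding the level sets of `f` in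
increasing order leads from `U` to `T`. The induction peels off the largest value. -/
theorem sum_sublevel_sub_sublevel (f : ι → ℝ) (S U : Set ι) (h : Set ι → M) (A : Finset ℝ)
    (hU : ∀ σ ∈ U, ∀ τ ∈ S, f τ ≤ f σ → τ ∈ U) :
    ∀ T : Set ι, T ⊆ S → U ⊆ T → (∀ σ ∈ T, ∀ τ ∈ S, f τ ≤ f σ → τ ∈ T) →
      (A : Set ℝ) = f '' (T \ U) →
      ∑ a ∈ A, (h {σ ∈ S | f σ ≤ a} - h {σ ∈ S | f σ < a}) = h T - h U := by
  induction A using Finset.induction_on_max with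
  | empty =>
    intro T _ hUT _ hA
    rw [Finset.coe_empty, eq_comm, Set.image_eq_empty, Set.sdiff_eq_empty] at hA
    rw [hA.antisymm hUT, Finset.sum_empty, sub_self]
  | insert a A hmax ih =>
    intro T hTS hUT hT hA
    have ha : a ∉ A := fun h => lt_irrefl a (hmax a h)
    obtain ⟨τ, ⟨hτT, hτU⟩, rfl⟩ : a ∈ f '' (T \ U) := by
      rw [← hA]
      simp
    have hle : ∀ σ ∈ T \ U, f σ ≤ f τ := fun σ hσ => by
      have : f σ ∈ (insert (f τ) A : Finset ℝ) := by
        rw [← Finset.mem_coe, hA]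
        exact ⟨σ, hσ, rfl⟩
      rcases Finset.mem_insert.1 this with h | h
      · exact h.le
      · exact (hmax _ h).le
    have hlt : ∀ σ ∈ U, f σ < f τ := fun σ hσ => by
      by_contra hc
      exact hτU (hU σ hσ τ (hTS hτT) (not_lt.1 hc))
    have hTeq : {σ ∈ S | f σ ≤ f τ} = T := by
      ext σ
      refine ⟨fun hσ => hT τ hτT σ hσ.1 hσ.2, fun hσ => ⟨hTS hσ, ?_⟩⟩
      by_cases hσU : σ ∈ U
      · exact (hlt σ hσU).le
      · exact hle σ ⟨hσ, hσU⟩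
    rw [Finset.sum_insert ha, hTeq, ih {σ ∈ S | f σ < f τ} (fun σ hσ => hσ.1)
      (fun σ hσ => ⟨hTS (hUT hσ), hlt σ hσ⟩) (fun σ hσ ρ hρ hle => ⟨hρ, hle.trans_lt hσ.2⟩)]
    · abel
    · ext x
      constructor
      · intro hx
        have hx' : x ∈ f '' (T \ U) := by
          rw [← hA]
          exact Finset.mem_coe.2 (Finset.mem_insert_of_mem hx)
        obtain ⟨σ, hσ, rfl⟩ := hx'
        exact ⟨σ, ⟨⟨hTS hσ.1, hmax _ hx⟩, hσ.2⟩, rfl⟩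
      · rintro ⟨σ, ⟨⟨hσS, hσlt⟩, hσU⟩, rfl⟩
        have : f σ ∈ (insert (f τ) A : Finset ℝ) := by
          rw [← Finset.mem_coe, hA]
          exact ⟨σ, ⟨hT τ hτT σ hσS hσlt.le, hσU⟩, rfl⟩
        exact (Finset.mem_insert.1 this).resolve_left hσlt.ne

/-- By `hfg`, `g` is a nondecreasing function of `f` on `S`, so the jump of the `g`-filtration at
`b` splits into the jumps of the `f`-filtration at the values merged into `b`. -/
theorem sum_sublevel_sub_sublevel_of_coarser {S : Set ι} {f g : ι → ℝ}
    (hfg : ∀ σ ∈ S, ∀ τ ∈ S, f σ ≤ f τ → g σ ≤ g τ) (h : Set ι → M) {b : ℝ} {A : Finset ℝ}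
    (hA : (A : Set ℝ) = f '' {σ ∈ S | g σ = b}) :
    ∑ a ∈ A, (h {σ ∈ S | f σ ≤ a} - h {σ ∈ S | f σ < a}) =
      h {σ ∈ S | g σ ≤ b} - h {σ ∈ S | g σ < b} := by
  refine sum_sublevel_sub_sublevel f S {σ ∈ S | g σ < b} h A
    (fun σ hσ τ hτ hle => ⟨hτ, (hfg τ hτ σ hσ.1 hle).trans_lt hσ.2⟩) {σ ∈ S | g σ ≤ b} (fun σ hσ => hσ.1)
    (fun σ hσ => ⟨hσ.1, hσ.2.le⟩) (fun σ hσ τ hτ hle => ⟨hτ, (hfg τ hτ σ hσ.1 hle).trans hσ.2⟩) ?_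
  rw [hA]
  congr 1
  ext σ
  simp only [Set.mem_ofPred_eq, Set.mem_sdiff]
  constructor
  · rintro ⟨h1, h2⟩
    exact ⟨⟨h1, h2.le⟩, fun h3 => h3.2.ne h2⟩
  · rintro ⟨⟨h1, h2⟩, h3⟩
    exact ⟨h1, h2.eq_of_not_lt fun h4 => h3 ⟨h1, h4⟩⟩

end Telescoping

variable {V : Type*}

/-- Combinations of the `k`-dimensional simplices of `S`. -/
def chainsOn (k : ℕ) (S : Set (Finset V)) : Submodule (ZMod 2) (Finset V → ZMod 2) where
  carrier := {c | ∀ σ, c σ ≠ 0 → σ ∈ S ∧ σ.card = k + 1}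
  zero_mem' := fun _ h => absurd rfl h
  add_mem' := fun {c e} hc he σ h => by
    by_cases h0 : c σ = 0
    · exact he σ fun h1 => h (by simp [h0, h1])
    · exact hc σ h0
  smul_mem' := fun a c hc σ h => hc σ fun h0 => h (by simp [h0])

theorem chains_eq_chainsOn (K : FilteredComplex V) (k : ℕ) (α : ℝ) {S : Set (Finset V)}
    (hS : ∀ σ : Finset V, σ.Nonempty → (σ ∈ K.faces α ↔ σ ∈ S)) :
    K.chains k α = chainsOn k S := by
  ext c
  refine forall_congr' fun σ => imp_congr_right fun _ => and_congr_left fun h => hS σ ?_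
  rw [← Finset.card_pos]
  omega

variable [Fintype V] [DecidableEq V]

/-- The `k`-cycles supported on `S`. -/
def cyclesOn (k : ℕ) (S : Set (Finset V)) : Submodule (ZMod 2) (Finset V → ZMod 2) :=
  chainsOn k S ⊓ LinearMap.ker (boundary V)

/-- The boundaries of the `(k + 1)`-chains supported on `S`. -/
def boundariesOn (k : ℕ) (S : Set (Finset V)) : Submodule (ZMod 2) (Finset V → ZMod 2) :=
  (chainsOn (k + 1) S).map (boundary V)

/-- The dimension of the space of `k`-cycles supported on `S` that belong to `D`. -/
def cycleRank (k : ℕ) (D : Submodule (ZMod 2) (Finset V → ZMod 2)) (S : Set (Finset V)) : ℤ :=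
  Module.finrank (ZMod 2) (cyclesOn k S ⊓ D : Submodule (ZMod 2) (Finset V → ZMod 2))

/-- The nonempty simplices of `K` at each threshold are those of `S` on which `f` is at most
the threshold. -/
def IsSublevel (K : FilteredComplex V) (S : Set (Finset V)) (f : Finset V → ℝ) : Prop :=
  ∀ σ : Finset V, σ.Nonempty → ∀ α, σ ∈ K.faces α ↔ σ ∈ S ∧ f σ ≤ α

variable {K L : FilteredComplex V} {S : Set (Finset V)} {f g : Finset V → ℝ}

theorem IsSublevel.cycles_eq (hK : K.IsSublevel S f) (k : ℕ) {α : ℝ} {T : Set (Finset V)}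
    (hT : {σ ∈ S | f σ ≤ α} = T) : K.cycles k α = cyclesOn k T := by
  rw [cycles, cyclesOn, chains_eq_chainsOn K k α fun σ hσ => ?_]
  rw [hK σ hσ, ← hT, Set.mem_ofPred_eq]

theorem IsSublevel.boundaries_eq (hK : K.IsSublevel S f) (k : ℕ) {α : ℝ} {T : Set (Finset V)}
    (hT : {σ ∈ S | f σ ≤ α} = T) : K.boundaries k α = boundariesOn k T := by
  rw [boundaries, boundariesOn, chains_eq_chainsOn K (k + 1) α fun σ hσ => ?_]
  rw [hK σ hσ, ← hT, Set.mem_ofPred_eq]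

theorem exists_lt_sublevel_eq {ι : Type*} [Finite ι] (S : Set ι) (f : ι → ℝ) {c b : ℝ}
    (h : c < b) : ∃ s, c ≤ s ∧ s < b ∧ {σ ∈ S | f σ ≤ s} = {σ ∈ S | f σ < b} := by
  have hfin : (insert c (f '' {σ | f σ < b})).Finite := (Set.toFinite _).insert c
  obtain ⟨s, hs, hmax⟩ := Set.exists_max_image _ id hfin (Set.insert_nonempty _ _)
  have hsb : s < b := by
    rcases hs with rfl | ⟨σ, hσ, rfl⟩
    exacts [h, hσ]
  refine ⟨s, hmax c (Set.mem_insert _ _), hsb, ?_⟩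
  ext σ
  refine and_congr_right fun _ => ⟨fun h => h.trans_lt hsb, fun h => hmax _ (Or.inr ⟨σ, h, rfl⟩)⟩

/-- A mixed second difference of the dimension of `cyclesOn k T ⊓ boundariesOn k U`: in `T` across
the birth, in `U` across the death. In this form it can be telescoped in each variable separately.
-/
theorem IsSublevel.barcode_coe (hK : K.IsSublevel S f) (k : ℕ) {b d : ℝ} (hbd : b < d) :
    (K.barcode k (b, (d : EReal)) : ℤ) =
      (cycleRank k (boundariesOn k {σ ∈ S | f σ ≤ d}) {σ ∈ S | f σ ≤ b} -
        cycleRank k (boundariesOn k {σ ∈ S | f σ ≤ d}) {σ ∈ S | f σ < b}) -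
      (cycleRank k (boundariesOn k {σ ∈ S | f σ < d}) {σ ∈ S | f σ ≤ b} -
        cycleRank k (boundariesOn k {σ ∈ S | f σ < d}) {σ ∈ S | f σ < b}) := by
  obtain ⟨s, -, hsb, hs⟩ := exists_lt_sublevel_eq S f (sub_one_lt b)
  obtain ⟨t, hbt, htd, ht⟩ := exists_lt_sublevel_eq S f hbd
  have key := K.barcode_add_finrank k (b := b) (s := s) (t := t) (d := d) (D := K.boundaries k d)
    hsb (fun s' hs' => ?_) hbt (EReal.coe_lt_coe_iff.2 htd) (fun t' _ ht' => ?_)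
    (fun x => ⟨fun hx t _ h => K.boundaries_mono k (EReal.coe_le_coe_iff.1 h) hx,
      fun h => h d hbd.le le_rfl⟩)
  · rw [hK.cycles_eq k hs, hK.cycles_eq k rfl, hK.boundaries_eq k ht, hK.boundaries_eq k rfl] at key
    simp only [cycleRank]
    omega
  · rw [hK.cycles_eq k hs, hK.cycles_eq k rfl]
    refine inf_le_inf_right _ fun c hc σ hσ => ⟨⟨(hc σ hσ).1.1, (hc σ hσ).1.2.trans_lt hs'⟩, (hc σ hσ).2⟩
  · rw [hK.boundaries_eq k ht, hK.boundaries_eq k rfl]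
    exact Submodule.map_mono fun c hc σ hσ =>
      ⟨⟨(hc σ hσ).1.1, (hc σ hσ).1.2.trans_lt (EReal.coe_lt_coe_iff.1 ht')⟩, (hc σ hσ).2⟩

theorem IsSublevel.barcode_top (hK : K.IsSublevel S f) (k : ℕ) (b : ℝ) :
    (K.barcode k (b, ⊤) : ℤ) =
      (cycleRank k ⊤ {σ ∈ S | f σ ≤ b} - cycleRank k ⊤ {σ ∈ S | f σ < b}) -
      (cycleRank k (boundariesOn k S) {σ ∈ S | f σ ≤ b} -
        cycleRank k (boundariesOn k S) {σ ∈ S | f σ < b}) := by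
  obtain ⟨s, -, hsb, hs⟩ := exists_lt_sublevel_eq S f (sub_one_lt b)
  obtain ⟨t, hbt, ht⟩ : ∃ t, b ≤ t ∧ {σ ∈ S | f σ ≤ t} = S := by
    obtain ⟨C, hC⟩ := (Set.finite_range f).bddAbove
    refine ⟨max b C, le_max_left _ _, ?_⟩
    ext σ
    exact and_iff_left ((hC ⟨σ, rfl⟩).trans (le_max_right _ _))
  have key := K.barcode_add_finrank k (b := b) (s := s) (t := t) (d := ⊤) (D := ⊤)
    hsb (fun s' hs' => ?_) hbt (EReal.coe_lt_top t) (fun t' _ _ => ?_)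
    (fun x => ⟨fun hx t _ h => absurd h (EReal.coe_lt_top t).not_ge, fun _ => trivial⟩)
  · rw [hK.cycles_eq k hs, hK.cycles_eq k rfl, hK.boundaries_eq k ht] at key
    simp only [cycleRank]
    omega
  · rw [hK.cycles_eq k hs, hK.cycles_eq k rfl]
    refine inf_le_inf_right _ fun c hc σ hσ => ⟨⟨(hc σ hσ).1.1, (hc σ hσ).1.2.trans_lt hs'⟩, (hc σ hσ).2⟩
  · rw [hK.boundaries_eq k ht, hK.boundaries_eq k rfl]
    exact Submodule.map_mono fun c hc σ hσ => ⟨(hc σ hσ).1.1, (hc σ hσ).2⟩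

theorem sublevel_eq_of_forall_ne {ι : Type*} {S : Set ι} {f : ι → ℝ} {b : ℝ}
    (h : ∀ σ ∈ S, f σ ≠ b) : {σ ∈ S | f σ ≤ b} = {σ ∈ S | f σ < b} := by
  ext σ
  exact and_congr_right fun hσ => ⟨fun hle => hle.lt_of_ne (h σ hσ), le_of_lt⟩

/-- The births are values of the filtration function, and so are the finite deaths. -/
theorem IsSublevel.exists_of_barcode_ne_zero (hK : K.IsSublevel S f) (k : ℕ) {p : ℝ × EReal}
    (hp : K.barcode k p ≠ 0) :
    (p.1 : EReal) < p.2 ∧ (∃ σ ∈ S, f σ = p.1) ∧ (p.2 = ⊤ ∨ ∃ τ ∈ S, p.2 = (f τ : EReal)) := by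
  obtain ⟨b, d⟩ := p
  have hbd : (b : EReal) < d := by
    by_contra h
    exact hp (K.barcode_eq_zero_of_le k (not_lt.1 h))
  refine ⟨hbd, ?_⟩
  induction d with
  | bot => exact absurd hbd not_lt_bot
  | coe d =>
    have h := hK.barcode_coe k (EReal.coe_lt_coe_iff.1 hbd)
    constructor
    · by_contra! hne
      rw [sublevel_eq_of_forall_ne hne] at h
      simp only [sub_self, Nat.cast_eq_zero] at h
      exact hp h
    · right
      by_contra! hne
      rw [sublevel_eq_of_forall_ne (b := d) fun σ hσ hd => hne σ hσ (by simp [hd])] at h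
      simp only [sub_self, Nat.cast_eq_zero] at h
      exact hp h
  | top =>
    refine ⟨?_, Or.inl rfl⟩
    have h := hK.barcode_top k b
    by_contra! hne
    rw [sublevel_eq_of_forall_ne hne] at h
    simp only [sub_self, Nat.cast_eq_zero] at h
    exact hp h

theorem IsSublevel.barcode_coe_eq_sum (hK : K.IsSublevel S f) (hL : L.IsSublevel S g)
    (hfg : ∀ σ ∈ S, ∀ τ ∈ S, f σ ≤ f τ → g σ ≤ g τ) (k : ℕ) {b d : ℝ} (hbd : b < d)
    {A C : Finset ℝ} (hA : (A : Set ℝ) = f '' {σ ∈ S | g σ = b})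
    (hC : (C : Set ℝ) = f '' {σ ∈ S | g σ = d}) :
    L.barcode k (b, (d : EReal)) = ∑ c ∈ C, ∑ a ∈ A, K.barcode k (a, (c : EReal)) := by
  -- The second-difference formula holds for proper intervals only, so every pair in the double sum
  -- has to be one.
  have hlt : ∀ c ∈ C, ∀ a ∈ A, a < c := by
    intro c hc a ha
    rw [← Finset.mem_coe, hC] at hc
    rw [← Finset.mem_coe, hA] at ha
    obtain ⟨τ, ⟨hτ, rfl⟩, rfl⟩ := hc
    obtain ⟨σ, ⟨hσ, rfl⟩, rfl⟩ := ha
    by_contra hle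
    exact hbd.not_ge (hfg τ hτ σ hσ (not_lt.1 hle))
  zify
  rw [hL.barcode_coe k hbd]
  let h (c : ℝ) (T : Set (Finset V)) : ℤ :=
    cycleRank k (boundariesOn k {σ ∈ S | f σ ≤ c}) T -
      cycleRank k (boundariesOn k {σ ∈ S | f σ < c}) T
  have h1 : ∀ c ∈ C, ∑ a ∈ A, (K.barcode k (a, (c : EReal)) : ℤ) =
      h c {σ ∈ S | g σ ≤ b} - h c {σ ∈ S | g σ < b} := by
    intro c hc
    rw [← sum_sublevel_sub_sublevel_of_coarser hfg (h c) hA]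
    refine Finset.sum_congr rfl fun a ha => ?_
    rw [hK.barcode_coe k (hlt c hc a ha)]
    simp only [h]
    ring
  rw [Finset.sum_congr rfl h1]
  let h' (U : Set (Finset V)) : ℤ :=
    cycleRank k (boundariesOn k U) {σ ∈ S | g σ ≤ b} -
      cycleRank k (boundariesOn k U) {σ ∈ S | g σ < b}
  change h' {σ ∈ S | g σ ≤ d} - h' {σ ∈ S | g σ < d} = _
  rw [← sum_sublevel_sub_sublevel_of_coarser hfg h' hC]
  refine Finset.sum_congr rfl fun c _ => ?_
  simp only [h, h']
  ring

theorem IsSublevel.barcode_top_eq_sum (hK : K.IsSublevel S f) (hL : L.IsSublevel S g)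
    (hfg : ∀ σ ∈ S, ∀ τ ∈ S, f σ ≤ f τ → g σ ≤ g τ) (k : ℕ) {b : ℝ}
    {A : Finset ℝ} (hA : (A : Set ℝ) = f '' {σ ∈ S | g σ = b}) :
    L.barcode k (b, ⊤) = ∑ a ∈ A, K.barcode k (a, ⊤) := by
  zify
  let h (T : Set (Finset V)) : ℤ := cycleRank k ⊤ T - cycleRank k (boundariesOn k S) T
  have h1 : (L.barcode k (b, ⊤) : ℤ) = h {σ ∈ S | g σ ≤ b} - h {σ ∈ S | g σ < b} := by
    rw [hL.barcode_top k b]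
    simp only [h]
    ring
  rw [h1, ← sum_sublevel_sub_sublevel_of_coarser hfg h hA]
  refine Finset.sum_congr rfl fun a _ => ?_
  rw [hK.barcode_top k a]
  simp only [h]
  ring

end FilteredComplex

end

/-! ### The bottleneck distance as a pseudometric, and matchings induced by maps of intervals. -/

noncomputable section

namespace Barcode

theorem Close.symm {δ : ℝ≥0} {p q : ℝ × EReal} (h : Close δ p q) : Close δ q p :=
  ⟨by rw [abs_sub_comm]; exact h.1, h.2.2, h.2.1⟩

theorem add_coe_le_add_coe {x y z : EReal} {δ ε : ℝ≥0} (h1 : x ≤ y + ((δ : ℝ) : EReal))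
    (h2 : y ≤ z + ((ε : ℝ) : EReal)) : x ≤ z + (((δ + ε : ℝ≥0) : ℝ) : EReal) := by
  refine h1.trans ((add_le_add_left h2 _).trans_eq ?_)
  rw [add_assoc, ← EReal.coe_add, NNReal.coe_add, add_comm (δ : ℝ)]

theorem Close.trans {δ ε : ℝ≥0} {p q r : ℝ × EReal} (h : Close δ p q) (h' : Close ε q r) :
    Close (δ + ε) p r := by
  refine ⟨?_, add_coe_le_add_coe h.2.1 h'.2.1, ?_⟩
  · have := abs_sub_le p.1 q.1 r.1
    have h1 := h.1
    have h2 := h'.1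
    push_cast
    linarith
  · rw [add_comm δ]
    exact add_coe_le_add_coe h'.2.2 h.2.2

theorem Close.short {δ ε : ℝ≥0} {p q : ℝ × EReal} (h : Close δ p q) (h' : Short ε q) :
    Short (δ + ε) p := by
  refine h.2.1.trans ((add_le_add_left h' _).trans ?_)
  rw [← EReal.coe_add, EReal.coe_le_coe_iff]
  have := (abs_le.1 h.1).1
  push_cast
  linarith

theorem Short.mono {δ ε : ℝ≥0} {p : ℝ × EReal} (h : Short δ p) (hle : δ ≤ ε) : Short ε p := by
  refine h.trans (EReal.coe_le_coe_iff.2 ?_)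
  have : (δ : ℝ) ≤ ε := hle
  linarith

theorem Matched.refl (B : Barcode) : Matched 0 B B := by
  refine ⟨PEquiv.refl _, fun x y h => ?_, fun x h => ?_, fun x h => ?_⟩
  · obtain rfl : x = y := by simpa using h
    simp [Close]
  · simp at h
  · simp at h

theorem Matched.symm {δ : ℝ≥0} {B C : Barcode} (h : Matched δ B C) : Matched δ C B := by
  obtain ⟨f, h1, h2, h3⟩ := h
  exact ⟨f.symm, fun x y hxy => (h1 y x ((PEquiv.eq_some_iff f).1 hxy)).symm, h3, h2⟩

theorem Matched.trans {δ ε : ℝ≥0} {B C D : Barcode} (h : Matched δ B C) (h' : Matched ε C D) :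
    Matched (δ + ε) B D := by
  obtain ⟨f, f1, f2, f3⟩ := h
  obtain ⟨g, g1, g2, g3⟩ := h'
  have main : ∀ {δ ε : ℝ≥0} {B C D : Barcode} (f : B.Bar ≃. C.Bar) (g : C.Bar ≃. D.Bar),
      (∀ x y, f x = some y → Close δ x.1 y.1) → (∀ x, f x = none → Short δ x.1) →
      (∀ x, g x = none → Short ε x.1) → ∀ x, (f.trans g) x = none → Short (δ + ε) x.1 := by
    intro δ ε B C D f g f1 f2 g2 x hx
    cases hfx : f x with
    | none => exact (f2 x hfx).mono le_self_add
    | some y =>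
      refine (f1 x y hfx).short (g2 y ?_)
      rw [PEquiv.trans] at hx
      simpa [hfx] using hx
  refine ⟨f.trans g, fun x z hxz => ?_, main f g f1 f2 g2, fun z hz => ?_⟩
  · obtain ⟨y, hxy, hyz⟩ := (PEquiv.mem_trans f g x z).1 hxz
    exact (f1 x y hxy).trans (g1 y z hyz)
  · rw [add_comm]
    rw [PEquiv.symm_trans_rev] at hz
    exact main g.symm f.symm (fun x y h => (g1 y x ((PEquiv.eq_some_iff g).1 h)).symm) g3 f3 z hz

theorem Matched.bottleneckDist_le {δ : ℝ≥0} {B C : Barcode} (h : Matched δ B C) :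
    bottleneckDist B C ≤ δ :=
  iInf₂_le δ h

theorem bottleneckDist_self (B : Barcode) : bottleneckDist B B = 0 :=
  nonpos_iff_eq_zero.1 (Matched.refl B).bottleneckDist_le

theorem bottleneckDist_comm (B C : Barcode) : bottleneckDist B C = bottleneckDist C B :=
  le_antisymm (le_iInf₂ fun _ h => h.symm.bottleneckDist_le)
    (le_iInf₂ fun _ h => h.symm.bottleneckDist_le)

theorem bottleneckDist_triangle (B C D : Barcode) :
    bottleneckDist B D ≤ bottleneckDist B C + bottleneckDist C D := by
  simp only [bottleneckDist, ENNReal.iInf_add, ENNReal.add_iInf]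
  refine le_iInf₂ fun ε hε => le_iInf₂ fun δ hδ => ?_
  rw [← ENNReal.coe_add]
  exact (hδ.trans hε).bottleneckDist_le

theorem nonempty_bar_equiv_fin (B : Barcode) (P : ℝ × EReal → Prop) (A : Finset (ℝ × EReal))
    (hA : ∀ p, B p ≠ 0 → (P p ↔ p ∈ A)) :
    Nonempty ({x : B.Bar // P x.1} ≃ Fin (∑ p ∈ A, B p)) := by
  have hne : ∀ x : B.Bar, B x.1 ≠ 0 := fun x h => (Fin.cast h x.2).elim0
  let e : {x : B.Bar // P x.1} ≃ Σ p : A, Fin (B p) :=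
    { toFun := fun x => ⟨⟨x.1.1, (hA _ (hne x.1)).1 x.2⟩, x.1.2⟩
      invFun := fun x => ⟨⟨x.1.1, x.2⟩, (hA _ (hne ⟨x.1.1, x.2⟩)).2 x.1.2⟩
      left_inv := fun _ => rfl
      right_inv := fun _ => rfl }
  refine ⟨e.trans (Fintype.equivFinOfCardEq ?_)⟩
  rw [Fintype.card_sigma]
  simp only [Fintype.card_fin]
  exact Finset.sum_coe_sort A B

/-- If the bars of `C` are the images under `ψ` of the bars of `B`, without those whose image is
not a proper interval, then moving the bars along `ψ` is a partial matching. -/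
theorem matched_of_map {B C : Barcode} {δ : ℝ≥0} (ψ : ℝ × EReal → ℝ × EReal)
    (hC : ∀ q, ¬ (q.1 : EReal) < q.2 → C q = 0)
    (hsum : ∀ q : ℝ × EReal, (q.1 : EReal) < q.2 → ∃ A : Finset (ℝ × EReal),
      (∀ p, B p ≠ 0 → (ψ p = q ↔ p ∈ A)) ∧ C q = ∑ p ∈ A, B p)
    (hclose : ∀ p, B p ≠ 0 → ((ψ p).1 : EReal) < (ψ p).2 → Close δ p (ψ p))
    (hshort : ∀ p, B p ≠ 0 → ¬ ((ψ p).1 : EReal) < (ψ p).2 → Short δ p) :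
    Matched δ B C := by
  classical
  have hne : ∀ x : B.Bar, B x.1 ≠ 0 := fun x h => (Fin.cast h x.2).elim0
  -- Over each `q` there are as many bars of `B` sent to `q` as bars of `C` equal to `q`. Bijections
  -- chosen fibre by fibre glue to a bijection onto all the bars of `C`, so only bars of `B` remain
  -- unmatched.
  have hfib : ∀ q, Nonempty ({x : {x : B.Bar // ((ψ x.1).1 : EReal) < (ψ x.1).2} // ψ x.1.1 = q} ≃
      {y : C.Bar // y.1 = q}) := by
    intro q
    by_cases hq : (q.1 : EReal) < q.2
    · obtain ⟨A, hA, hCq⟩ := hsum q hq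
      obtain ⟨e1⟩ := nonempty_bar_equiv_fin B (fun p => ψ p = q) A hA
      obtain ⟨e2⟩ := nonempty_bar_equiv_fin C (fun p => p = q) {q} (fun p _ => by simp)
      rw [Finset.sum_singleton, hCq] at e2
      refine ⟨Equiv.trans ?_ (e1.trans e2.symm)⟩
      exact Equiv.subtypeSubtypeEquivSubtype
        (p := fun x : B.Bar => ((ψ x.1).1 : EReal) < (ψ x.1).2) (q := fun x => ψ x.1 = q)
        (fun {x} hx => by rw [hx]; exact hq)
    · have h1 : IsEmpty {x : {x : B.Bar // ((ψ x.1).1 : EReal) < (ψ x.1).2} // ψ x.1.1 = q} :=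
        ⟨fun x => hq (x.2 ▸ x.1.2)⟩
      have h2 : IsEmpty {y : C.Bar // y.1 = q} :=
        ⟨fun y => (Fin.cast ((congrArg C y.2).trans (hC q hq)) y.1.2).elim0⟩
      exact ⟨Equiv.equivOfIsEmpty _ _⟩
  let e : {x : B.Bar // ((ψ x.1).1 : EReal) < (ψ x.1).2} ≃ C.Bar :=
    Equiv.ofFiberEquiv (f := fun x => ψ x.1.1) (g := fun y : C.Bar => y.1)
      fun q => (hfib q).some
  have he : ∀ x, (e x).1 = ψ x.1.1 := fun x => Equiv.ofFiberEquiv_map _ x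
  refine ⟨⟨fun x => if h : ((ψ x.1).1 : EReal) < (ψ x.1).2 then some (e ⟨x, h⟩) else none,
    fun y => some (e.symm y).1, fun x y => ?_⟩, fun x y hxy => ?_, fun x hx => ?_, fun y hy => ?_⟩
  · by_cases h : ((ψ x.1).1 : EReal) < (ψ x.1).2
    · simp only [dif_pos h, Option.some_inj]
      constructor
      · intro hx
        rw [show (⟨x, h⟩ : {x : B.Bar // ((ψ x.1).1 : EReal) < (ψ x.1).2}) = e.symm y from
          Subtype.ext hx.symm, e.apply_symm_apply]
      · rintro rfl
        simp
    · simp only [dif_neg h, Option.some_inj]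
      refine ⟨fun hx => absurd (hx ▸ (e.symm y).2) h, fun hx => by simp at hx⟩
  · change (if h : ((ψ x.1).1 : EReal) < (ψ x.1).2 then some (e ⟨x, h⟩) else none) = some y at hxy
    split_ifs at hxy with h
    rw [← Option.some_inj.1 hxy, he]
    exact hclose _ (hne x) h
  · change (if h : ((ψ x.1).1 : EReal) < (ψ x.1).2 then some (e ⟨x, h⟩) else none) = none at hx
    split_ifs at hx with h
    exact hshort _ (hne x) h
  · exact absurd hy (Option.some_ne_none _)

end Barcode

namespace FilteredComplex

variable {V : Type*} [Fintype V] [DecidableEq V] {K L : FilteredComplex V} {S : Set (Finset V)}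
  {f g : Finset V → ℝ}

/-- Two filtrations of the same complex, one of which refines the other, have close barcodes. -/
theorem IsSublevel.matched_of_coarser (hK : K.IsSublevel S f) (hL : L.IsSublevel S g)
    (hfg : ∀ σ ∈ S, ∀ τ ∈ S, f σ ≤ f τ → g σ ≤ g τ) (k : ℕ) {δ : ℝ≥0}
    (hδ : ∀ σ ∈ S, |f σ - g σ| ≤ δ) : Barcode.Matched δ (K.barcode k) (L.barcode k) := by
  classical
  obtain ⟨φ, hφ⟩ : ∃ φ : ℝ → ℝ, ∀ σ ∈ S, φ (f σ) = g σ := by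
    have : Function.FactorsThrough (fun σ : S => g σ) (fun σ : S => f σ) := fun σ τ h =>
      le_antisymm (hfg σ σ.2 τ τ.2 (le_of_eq h)) (hfg τ τ.2 σ σ.2 (ge_of_eq h))
    obtain ⟨φ, h⟩ := (Function.factorsThrough_iff _).1 this
    exact ⟨φ, fun σ hσ => (congrFun h ⟨σ, hσ⟩).symm⟩
  have hset : ∀ b : ℝ, ∃ A : Finset ℝ, (A : Set ℝ) = f '' {σ ∈ S | g σ = b} := fun b =>
    (Set.toFinite _).exists_finset_coe
  have hmem : ∀ {b : ℝ} {A : Finset ℝ}, (A : Set ℝ) = f '' {σ ∈ S | g σ = b} →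
      ∀ σ ∈ S, (φ (f σ) = b ↔ f σ ∈ A) := by
    intro b A hA σ hσ
    rw [← Finset.mem_coe, hA, hφ σ hσ]
    refine ⟨fun h => ⟨σ, ⟨hσ, h⟩, rfl⟩, ?_⟩
    rintro ⟨τ, ⟨hτ, rfl⟩, h⟩
    rw [← hφ σ hσ, ← h, hφ τ hτ]
  -- Both end points move by `φ`. The value at a death `⊥` is irrelevant, as no bar has one.
  let ψ : ℝ × EReal → ℝ × EReal := fun p =>
    (φ p.1, if p.2 = ⊤ then ⊤ else ((φ p.2.toReal : ℝ) : EReal))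
  have hψtop : ∀ a : ℝ, ψ (a, ⊤) = (φ a, ⊤) := fun a => by simp [ψ]
  have hψcoe : ∀ a c : ℝ, ψ (a, (c : EReal)) = (φ a, ((φ c : ℝ) : EReal)) := fun a c => by
    simp [ψ]
  refine Barcode.matched_of_map ψ (fun q hq => L.barcode_eq_zero_of_le k (not_lt.1 hq)) ?_ ?_ ?_
  · rintro ⟨b, d⟩ hbd
    obtain ⟨A, hA⟩ := hset b
    induction d with
    | bot => exact absurd hbd not_lt_bot
    | coe d =>
      obtain ⟨C, hC⟩ := hset d
      obtain ⟨j, hj⟩ : ∃ j : ℝ × ℝ ↪ ℝ × EReal, ∀ x, j x = (x.2, (x.1 : EReal)) :=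
        ⟨⟨fun x => (x.2, (x.1 : EReal)), fun x y h => by
          simp only [Prod.mk.injEq, EReal.coe_eq_coe_iff] at h
          exact Prod.ext h.2 h.1⟩, fun _ => rfl⟩
      refine ⟨(C ×ˢ A).map j, fun p hp => ?_, ?_⟩
      · obtain ⟨-, ⟨σ, hσ, h1⟩, h2⟩ := hK.exists_of_barcode_ne_zero k hp
        obtain ⟨a, c⟩ := p
        obtain rfl : f σ = a := h1
        rcases h2 with h2 | ⟨τ, hτ, h2⟩
        · obtain rfl : c = ⊤ := h2
          rw [hψtop]
          simp [hj]
        · obtain rfl : c = (f τ : EReal) := h2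
          rw [hψcoe, Prod.mk.injEq, EReal.coe_eq_coe_iff, hmem hA σ hσ, hmem hC τ hτ]
          simp [hj, and_comm]
      · simp only [Finset.sum_map, Finset.sum_product, hj]
        exact hK.barcode_coe_eq_sum hL hfg k (EReal.coe_lt_coe_iff.1 hbd) hA hC
    | top =>
      obtain ⟨j, hj⟩ : ∃ j : ℝ ↪ ℝ × EReal, ∀ x, j x = (x, ⊤) :=
        ⟨⟨fun x => (x, ⊤), fun x y h => congrArg Prod.fst h⟩, fun _ => rfl⟩
      refine ⟨A.map j, fun p hp => ?_, ?_⟩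
      · obtain ⟨-, ⟨σ, hσ, h1⟩, h2⟩ := hK.exists_of_barcode_ne_zero k hp
        obtain ⟨a, c⟩ := p
        obtain rfl : f σ = a := h1
        rcases h2 with h2 | ⟨τ, hτ, h2⟩
        · obtain rfl : c = ⊤ := h2
          rw [hψtop, Prod.mk.injEq, hmem hA σ hσ]
          simp [hj]
        · obtain rfl : c = (f τ : EReal) := h2
          rw [hψcoe]
          simp [hj]
      · simp only [Finset.sum_map, hj]
        exact hK.barcode_top_eq_sum hL hfg k hA
  all_goals
    rintro ⟨a, c⟩ hp hgood
    obtain ⟨-, ⟨σ, hσ, h1⟩, h2⟩ := hK.exists_of_barcode_ne_zero k hp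
    obtain rfl : f σ = a := h1
    have hd1 := abs_le.1 (hδ σ hσ)
    rcases h2 with h2 | ⟨τ, hτ, h2⟩
  · obtain rfl : c = ⊤ := h2
    rw [hψtop, hφ σ hσ]
    refine ⟨hδ σ hσ, ?_, ?_⟩ <;> simp
  · obtain rfl : c = (f τ : EReal) := h2
    have hd2 := abs_le.1 (hδ τ hτ)
    rw [hψcoe, hφ σ hσ, hφ τ hτ]
    refine ⟨hδ σ hσ, ?_, ?_⟩
    all_goals
      rw [← EReal.coe_add, EReal.coe_le_coe_iff]
      linarith
  · obtain rfl : c = ⊤ := h2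
    rw [hψtop] at hgood
    exact absurd (EReal.coe_lt_top _) hgood
  · obtain rfl : c = (f τ : EReal) := h2
    have hd2 := abs_le.1 (hδ τ hτ)
    -- A bar that collapses has `g τ ≤ g σ`; each end point moved by at most `δ`, so its length was
    -- at most `2 δ`.
    rw [hψcoe, hφ σ hσ, hφ τ hτ, EReal.coe_lt_coe_iff, not_lt] at hgood
    rw [Barcode.Short, EReal.coe_le_coe_iff]
    simp only
    linarith

end FilteredComplex

end

/-! ### Stability of barcodes by interpolation. -/

noncomputable section

/-- A local Lipschitz bound along a segment is a global one. -/
theorem le_ofReal_of_locally_le (e : ℝ → ℝ → ℝ≥0∞) (he : e 0 0 = 0)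
    (htri : ∀ x y z, e x z ≤ e x y + e y z) {C : ℝ} (hC : 0 ≤ C)
    (hloc : ∀ x ∈ Set.Icc (0 : ℝ) 1, ∀ᶠ y in nhds x, y ∈ Set.Icc (0 : ℝ) 1 →
      e x y ≤ ENNReal.ofReal (|y - x| * C) ∧ e y x ≤ ENNReal.ofReal (|y - x| * C)) :
    e 0 1 ≤ ENNReal.ofReal C := by
  have hsub : Set.Icc (0 : ℝ) 1 ⊆ {t | e 0 t ≤ ENNReal.ofReal (t * C)} := by
    refine IsClosed.Icc_subset_of_forall_exists_gt ?_ (by simp [he]) ?_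
    · refine isClosed_of_closure_subset fun x hx => ?_
      have hxI : x ∈ Set.Icc (0 : ℝ) 1 :=
        (closure_minimal Set.inter_subset_right isClosed_Icc) hx
      refine ⟨ENNReal.le_of_forall_pos_le_add fun ε hε _ => ?_, hxI⟩
      -- The error `|y - x| * C` enters twice: in `e y x`, and in replacing `y * C` by `x * C`.
      have hsmall : ∀ᶠ y in nhds x, 2 * (|y - x| * C) < ε := by
        have hc : Continuous fun y : ℝ => 2 * (|y - x| * C) := by fun_prop
        exact hc.continuousAt.eventually (gt_mem_nhds (by simpa using hε))
      obtain ⟨y, ⟨hy, hyI⟩, h1, h2⟩ :=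
        ((mem_closure_iff_frequently.1 hx).and_eventually (hsmall.and (hloc x hxI))).exists
      refine (htri 0 y x).trans ((add_le_add hy (h2 hyI).2).trans ?_)
      rw [← ENNReal.ofReal_coe_nnreal (p := ε), ← ENNReal.ofReal_add (mul_nonneg hyI.1 hC)
        (mul_nonneg (abs_nonneg _) hC), ← ENNReal.ofReal_add (mul_nonneg hxI.1 hC) ε.coe_nonneg]
      refine ENNReal.ofReal_le_ofReal ?_
      have h3 : y * C ≤ (x + |y - x|) * C :=
        mul_le_mul_of_nonneg_right (by linarith [le_abs_self (y - x)]) hC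
      have h4 : 2 * (|y - x| * C) < (ε : ℝ) := h1
      linarith
    · rintro x ⟨hx, hxI⟩ y (hxy : x < y)
      have hxI' : x ∈ Set.Icc (0 : ℝ) 1 := ⟨hxI.1, hxI.2.le⟩
      have hev : ∀ᶠ z in nhdsWithin x (Set.Ioi x), z ∈ Set.Ioo x (min y 1) :=
        Ioo_mem_nhdsGT (lt_min hxy hxI.2)
      obtain ⟨z, hz, hz2⟩ := (hev.and (nhdsWithin_le_nhds (hloc x hxI'))).exists
      have hzy := hz.2.trans_le (min_le_left _ _)
      have hz1 := hz.2.trans_le (min_le_right _ _)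
      refine ⟨z, (htri 0 x z).trans ((add_le_add hx
        (hz2 ⟨hxI.1.trans hz.1.le, hz1.le⟩).1).trans ?_), hz.1, hzy.le⟩
      rw [← ENNReal.ofReal_add (mul_nonneg hxI.1 hC) (by positivity),
        abs_of_pos (sub_pos.2 hz.1)]
      exact ENNReal.ofReal_le_ofReal (by linarith)
  simpa using hsub (Set.right_mem_Icc.2 zero_le_one)

namespace FilteredComplex

variable {V : Type*} {K L : FilteredComplex V} {S : Set (Finset V)} {f g : Finset V → ℝ}

theorem exists_isSublevel
    (h : ∀ σ ∈ S, ∀ τ ⊆ σ, τ.Nonempty → τ ∈ S ∧ f τ ≤ f σ) :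
    ∃ K : FilteredComplex V, K.IsSublevel S f := by
  refine ⟨⟨fun α => {σ | σ.Nonempty → σ ∈ S ∧ f σ ≤ α}, fun α σ τ hσ hτσ hτ => ?_,
    fun α β hαβ σ hσ hne => ⟨(hσ hne).1, (hσ hne).2.trans hαβ⟩⟩,
    fun σ hσ α => ⟨fun h => h hσ, fun h _ => h⟩⟩
  have hσ' := hσ (hτ.mono hτσ)
  exact ⟨(h σ hσ'.1 τ hτσ hτ).1, (h σ hσ'.1 τ hτσ hτ).2.trans hσ'.2⟩

theorem IsSublevel.mono_of_subset (hK : K.IsSublevel S f) {σ τ : Finset V} (hσ : σ ∈ S)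
    (hτσ : τ ⊆ σ) (hτ : τ.Nonempty) : τ ∈ S ∧ f τ ≤ f σ :=
  (hK τ hτ _).1 (K.down_closed _ σ τ ((hK σ (hτ.mono hτσ) _).2 ⟨hσ, le_rfl⟩) hτσ)

variable [Fintype V] [DecidableEq V]

/-- **Stability of persistence barcodes** for filtrations of one finite simplicial complex. -/
theorem IsSublevel.bottleneckDist_le (hK : K.IsSublevel S f) (hL : L.IsSublevel S g) (k : ℕ)
    {C : ℝ} (hC : 0 ≤ C) (hfg : ∀ σ ∈ S, |f σ - g σ| ≤ C) :
    (K.barcode k).bottleneckDist (L.barcode k) ≤ ENNReal.ofReal C := by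
  let F (t : ℝ) (σ : Finset V) : ℝ := (1 - t) * f σ + t * g σ
  have hF : ∀ t ∈ Set.Icc (0 : ℝ) 1, ∃ M : FilteredComplex V, M.IsSublevel S (F t) := by
    intro t ht
    refine exists_isSublevel fun σ hσ τ hτσ hτ => ⟨(hK.mono_of_subset hσ hτσ hτ).1, ?_⟩
    exact add_le_add
      (mul_le_mul_of_nonneg_left (hK.mono_of_subset hσ hτσ hτ).2 (sub_nonneg.2 ht.2))
      (mul_le_mul_of_nonneg_left (hL.mono_of_subset hσ hτσ hτ).2 ht.1)
  -- `IsSublevel` says nothing about the empty simplex and so does not determine the filtration; `K`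
  -- and `L` are therefore prescribed at the ends of the path.
  have hex : ∀ t, ∃ M : FilteredComplex V, (t ∈ Set.Icc (0 : ℝ) 1 → M.IsSublevel S (F t)) ∧
      (t = 0 → M = K) ∧ (t = 1 → M = L) := by
    intro t
    rcases eq_or_ne t 0 with rfl | h0
    · exact ⟨K, fun _ => by simpa [F] using hK, fun _ => rfl, fun h => absurd h zero_ne_one⟩
    rcases eq_or_ne t 1 with rfl | h1
    · exact ⟨L, fun _ => by simpa [F] using hL, fun h => absurd h one_ne_zero, fun _ => rfl⟩
    by_cases ht : t ∈ Set.Icc (0 : ℝ) 1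
    · obtain ⟨M, hM⟩ := hF t ht
      exact ⟨M, fun _ => hM, fun h => absurd h h0, fun h => absurd h h1⟩
    · exact ⟨K, fun h => absurd h ht, fun h => absurd h h0, fun h => absurd h h1⟩
  choose M hM hM0 hM1 using hex
  have key := le_ofReal_of_locally_le
    (fun s t => ((M s).barcode k).bottleneckDist ((M t).barcode k))
    (Barcode.bottleneckDist_self _) (fun _ _ _ => Barcode.bottleneckDist_triangle _ _ _) hC ?_
  · rwa [hM0 0 rfl, hM1 1 rfl] at key
  intro x hx
  -- There are finitely many strict inequalities, and each is an open condition. By contraposition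
  -- `F y` orders simplices at least as finely as `F x`: ties at `x` may split at `y`, but no order
  -- is reversed.
  have hev : ∀ᶠ y in nhds x, ∀ σ τ, F x σ < F x τ → F y σ < F y τ := by
    refine Filter.eventually_all.2 fun σ => Filter.eventually_all.2 fun τ => ?_
    by_cases h : F x σ < F x τ
    · have hc : ∀ σ, Continuous fun y => F y σ := fun σ => by fun_prop
      filter_upwards [(hc σ).continuousAt.eventually_lt (hc τ).continuousAt h] with y hy _ using hy
    · exact Filter.Eventually.of_forall fun y h' => absurd h' h
  filter_upwards [hev] with y hy hyI
  have hm : Barcode.Matched (|y - x| * C).toNNReal ((M y).barcode k) ((M x).barcode k) := by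
    refine (hM y hyI).matched_of_coarser (hM x hx) (fun σ _ τ _ hle => ?_) k fun σ hσ => ?_
    · by_contra h
      exact (hy τ σ (not_le.1 h)).not_ge hle
    · rw [Real.coe_toNNReal _ (by positivity)]
      have h1 : F y σ - F x σ = (y - x) * (g σ - f σ) := by
        simp only [F]
        ring
      rw [h1, abs_mul, abs_sub_comm (g σ)]
      exact mul_le_mul_of_nonneg_left (hfg σ hσ) (abs_nonneg _)
  exact ⟨hm.symm.bottleneckDist_le, hm.bottleneckDist_le⟩

end FilteredComplex

/-! ### Vietoris–Rips filtrations -/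

section VietorisRips

open FilteredComplex

variable {V : Type*}

/-- The largest finite weight of an edge of a simplex (and `0` for the empty simplex). -/
def ripsDiam (m : V → V → EReal) (σ : Finset V) : ℝ :=
  if h : σ.Nonempty then (σ ×ˢ σ).sup' (h.product h) fun p => (m p.1 p.2).toReal else 0

/-- An edge of weight `⊤` never appears. On the remaining simplices all weights are finite and
`toReal` loses nothing. -/
theorem isSublevel_vietorisRips (m : V → V → EReal) (hm : ∀ i j, m i j ≠ ⊥) :
    (vietorisRips m).IsSublevel {σ | ∀ i ∈ σ, ∀ j ∈ σ, m i j ≠ ⊤} (ripsDiam m) := by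
  intro σ hσ α
  have h : ∀ i j, m i j ≤ (α : EReal) ↔ m i j ≠ ⊤ ∧ (m i j).toReal ≤ α := by
    intro i j
    by_cases ht : m i j = ⊤
    · simp [ht]
    · rw [and_iff_right ht, ← EReal.coe_le_coe_iff, EReal.coe_toReal ht (hm i j)]
  simp only [vietorisRips, Set.mem_ofPred_eq, h, ripsDiam, dif_pos hσ, Finset.sup'_le_iff,
    Finset.mem_product, Prod.forall]
  exact ⟨fun H => ⟨fun i hi j hj => (H i hi j hj).1, fun i j hij => (H i hij.1 j hij.2).2⟩,
    fun H i hi j hj => ⟨H.1 i hi j hj, H.2 i j ⟨hi, hj⟩⟩⟩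

theorem abs_ripsDiam_sub_le {m m' : V → V → EReal} {C : ℝ} (hC : 0 ≤ C)
    (h : ∀ i j, |(m i j).toReal - (m' i j).toReal| ≤ C) (σ : Finset V) :
    |ripsDiam m σ - ripsDiam m' σ| ≤ C := by
  by_cases hσ : σ.Nonempty
  · have main : ∀ {m m' : V → V → EReal}, (∀ i j, |(m i j).toReal - (m' i j).toReal| ≤ C) →
        ripsDiam m σ ≤ ripsDiam m' σ + C := by
      intro m m' h
      simp only [ripsDiam, dif_pos hσ]
      refine Finset.sup'_le _ _ fun p hp => ?_
      have h1 := Finset.le_sup' (fun p : V × V => (m' p.1 p.2).toReal) hp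
      have h2 := (abs_le.1 (h p.1 p.2)).2
      linarith
    have h1 := main h
    have h2 := main fun i j => abs_sub_comm (m i j).toReal _ ▸ h i j
    exact abs_le.2 ⟨by linarith, by linarith⟩
  · simpa [ripsDiam, hσ] using hC

theorem bottleneckDist_vietorisRips_le [Fintype V] [DecidableEq V] (k : ℕ) {m m' : V → V → EReal} {C : ℝ} (hC : 0 ≤ C)
    (hm : ∀ i j, m i j ≠ ⊥) (hm' : ∀ i j, m' i j ≠ ⊥) (htop : ∀ i j, m i j = ⊤ ↔ m' i j = ⊤)
    (h : ∀ i j, |(m i j).toReal - (m' i j).toReal| ≤ C) :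
    ((vietorisRips m).barcode k).bottleneckDist ((vietorisRips m').barcode k) ≤
      ENNReal.ofReal C := by
  have h' := isSublevel_vietorisRips m' hm'
  simp only [ne_eq, ← htop] at h'
  exact (isSublevel_vietorisRips m hm).bottleneckDist_le h' k hC
    fun σ _ => abs_ripsDiam_sub_le hC h σ

end VietorisRips

/-! ### Stability of the R-Cross-Barcode. -/

theorem crossMatrix_ne_bot {n : ℕ} (w w' : EdgeWeights n) (a b : Fin n ⊕ Fin n) :
    crossMatrix w w' a b ≠ ⊥ := by
  rcases a with i | i <;> rcases b with j | j <;> simp only [crossMatrix]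
  · exact EReal.zero_ne_bot
  · split_ifs <;> simp
  · split_ifs <;> simp
  · exact EReal.coe_ne_bot _

/-- The infinite entries depend only on the order of the indices; hence all doubled graphs filter
the same complex. -/
theorem crossMatrix_eq_top_iff {n : ℕ} (w w' v v' : EdgeWeights n) (a b : Fin n ⊕ Fin n) :
    crossMatrix w w' a b = ⊤ ↔ crossMatrix v v' a b = ⊤ := by
  rcases a with i | i <;> rcases b with j | j <;> simp only [crossMatrix]
  · split_ifs <;> simp
  · split_ifs <;> simp
  · simp only [EReal.coe_ne_top]

theorem bottleneckDist_rCrossBarcode_le_of_forall (k : ℕ) {n : ℕ} {w w' v v' : EdgeWeights n}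
    {C : ℝ} (hC : 0 ≤ C) (h : ∀ i j, |v.weight i j - w.weight i j| ≤ C)
    (h' : ∀ i j, |v'.weight i j - w'.weight i j| ≤ C) :
    (rCrossBarcode k w w').bottleneckDist (rCrossBarcode k v v') ≤ ENNReal.ofReal C := by
  have hs : ∀ i j, |w.weight i j - v.weight i j| ≤ C := fun i j => abs_sub_comm (v.weight i j) _ ▸ h i j
  have hs' : ∀ i j, |w'.weight i j - v'.weight i j| ≤ C := fun i j => abs_sub_comm (v'.weight i j) _ ▸ h' i j
  refine bottleneckDist_vietorisRips_le k hC (crossMatrix_ne_bot w w') (crossMatrix_ne_bot v v')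
    (crossMatrix_eq_top_iff w w' v v') fun a b => ?_
  rcases a with i | i <;> rcases b with j | j <;> simp only [crossMatrix]
  · simpa using hC
  · split_ifs
    · simpa using hs j i
    · simpa using hC
  · split_ifs
    · simpa using hs i j
    · simpa using hC
  · rw [EReal.toReal_coe, EReal.toReal_coe]
    exact (abs_min_sub_min_le_max _ _ _ _).trans (max_le (hs i j) (hs' i j))

theorem abs_sub_le_iSup {n : ℕ} (f g : Fin n → Fin n → ℝ) (i j : Fin n) :
    |f i j - g i j| ≤ ⨆ i, ⨆ j, |f i j - g i j| :=
  (le_ciSup (f := fun j => |f i j - g i j|) (Set.finite_range _).bddAbove j).trans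
    (le_ciSup (f := fun i => ⨆ j, |f i j - g i j|) (Set.finite_range _).bddAbove i)

theorem iSup_abs_sub_nonneg {n : ℕ} (f g : Fin n → Fin n → ℝ) :
    0 ≤ ⨆ i, ⨆ j, |f i j - g i j| :=
  Real.iSup_nonneg fun _ => Real.iSup_nonneg fun _ => abs_nonneg _

theorem bottleneckDist_rCrossBarcode_le (k : ℕ) {n : ℕ} (w w' v v' : EdgeWeights n) :
    (rCrossBarcode k w w').bottleneckDist (rCrossBarcode k v v') ≤
      ENNReal.ofReal (max (⨆ i, ⨆ j, |v.weight i j - w.weight i j|)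
        (⨆ i, ⨆ j, |v'.weight i j - w'.weight i j|)) :=
  bottleneckDist_rCrossBarcode_le_of_forall k
    (le_max_of_le_left (iSup_abs_sub_nonneg v.weight w.weight))
    (fun i j => le_max_of_le_left (abs_sub_le_iSup v.weight w.weight i j))
    (fun i j => le_max_of_le_right (abs_sub_le_iSup v'.weight w'.weight i j))

end

/-! ### Cones, dominated vertices, and acyclicity for equal weights. -/

noncomputable section

section Cone

open FilteredComplex

variable {V : Type*} [Fintype V] [DecidableEq V]

theorem boundary_single (σ : Finset V) :
    boundary V (Pi.single σ 1) = ∑ v ∈ σ, Pi.single (σ.erase v) 1 := by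
  rw [boundary, Fintype.linearCombination_apply_single, one_smul]

theorem exists_of_boundary_ne_zero {c : Finset V → ZMod 2} {τ : Finset V}
    (h : boundary V c τ ≠ 0) : ∃ σ, c σ ≠ 0 ∧ ∃ v ∈ σ, τ = σ.erase v := by
  rw [boundary, Fintype.linearCombination_apply, Finset.sum_apply] at h
  obtain ⟨σ, -, hσ⟩ := Finset.exists_ne_zero_of_sum_ne_zero h
  rw [Pi.smul_apply, Finset.sum_apply, smul_eq_mul] at hσ
  obtain ⟨v, hv, hvτ⟩ := Finset.exists_ne_zero_of_sum_ne_zero (right_ne_zero_of_mul hσ)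
  refine ⟨σ, left_ne_zero_of_mul hσ, v, hv, ?_⟩
  by_contra hne
  exact hvτ (Pi.single_eq_of_ne hne 1)

/-- The cone operator with apex `u`. -/
def cone (u : V) : (Finset V → ZMod 2) →ₗ[ZMod 2] (Finset V → ZMod 2) :=
  Fintype.linearCombination (ZMod 2) fun σ : Finset V =>
    if u ∈ σ then 0 else Pi.single (insert u σ) 1

theorem cone_single (u : V) (σ : Finset V) :
    cone u (Pi.single σ 1) = if u ∈ σ then 0 else Pi.single (insert u σ) 1 := by
  rw [cone, Fintype.linearCombination_apply_single, one_smul]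

theorem exists_of_cone_ne_zero {u : V} {c : Finset V → ZMod 2} {τ : Finset V}
    (h : cone u c τ ≠ 0) : ∃ σ, c σ ≠ 0 ∧ u ∉ σ ∧ τ = insert u σ := by
  rw [cone, Fintype.linearCombination_apply, Finset.sum_apply] at h
  obtain ⟨σ, -, hσ⟩ := Finset.exists_ne_zero_of_sum_ne_zero h
  rw [Pi.smul_apply, smul_eq_mul] at hσ
  have h2 := right_ne_zero_of_mul hσ
  split_ifs at h2 with hu
  · exact absurd rfl h2
  · refine ⟨σ, left_ne_zero_of_mul hσ, hu, ?_⟩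
    by_contra hne
    exact h2 (Pi.single_eq_of_ne hne 1)

theorem linearMap_ext_single {f g : (Finset V → ZMod 2) →ₗ[ZMod 2] (Finset V → ZMod 2)}
    (h : ∀ σ, f (Pi.single σ 1) = g (Pi.single σ 1)) : f = g :=
  (Pi.basisFun (ZMod 2) (Finset V)).ext fun σ => by simpa using h σ

/-- The cone is a contracting homotopy of the full simplex, augmented by the empty simplex. If `u ∈
σ`, only the facet opposite `u` contributes; otherwise the cones over the facets of `σ` cancel
modulo 2. -/
theorem boundary_cone_add (u : V) (c : Finset V → ZMod 2) :
    boundary V (cone u c) + cone u (boundary V c) = c := by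
  have h : boundary V ∘ₗ cone u + cone u ∘ₗ boundary V = LinearMap.id := by
    refine linearMap_ext_single fun σ => ?_
    simp only [LinearMap.add_apply, LinearMap.comp_apply, LinearMap.id_apply, cone_single,
      boundary_single, map_sum]
    by_cases hu : u ∈ σ
    · rw [if_pos hu, map_zero, zero_add, Finset.sum_eq_single_of_mem u hu,
        if_neg (Finset.notMem_erase u σ), Finset.insert_erase hu]
      intro v _ hv
      rw [if_pos (Finset.mem_erase.2 ⟨hv.symm, hu⟩)]
    · rw [if_neg hu, boundary_single, Finset.sum_insert hu, Finset.erase_insert hu, add_assoc,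
        ← Finset.sum_add_distrib, Finset.sum_eq_zero, add_zero]
      intro v hv
      have hne : u ≠ v := fun h => hu (h ▸ hv)
      rw [if_neg fun h => hu (Finset.mem_of_mem_erase h), Finset.erase_insert_of_ne hne]
      exact CharTwo.add_self_eq_zero _
  exact LinearMap.congr_fun h c

/-- Writing a simplex as a cone over a smaller one and applying the homotopy identity twice reduces
the claim to the smaller simplex. -/
theorem boundary_boundary (c : Finset V → ZMod 2) : boundary V (boundary V c) = 0 := by
  have h : boundary V ∘ₗ boundary V = 0 := by
    refine linearMap_ext_single fun σ => ?_
    rw [LinearMap.comp_apply, LinearMap.zero_apply]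
    induction σ using Finset.induction_on with
    | empty => rw [boundary_single, Finset.sum_empty, map_zero]
    | insert u σ hu ih =>
      have h1 : Pi.single (insert u σ) 1 = cone u (Pi.single σ (1 : ZMod 2)) := by
        rw [cone_single, if_neg hu]
      have h2 := boundary_cone_add u (Pi.single σ (1 : ZMod 2))
      have h3 := boundary_cone_add u (boundary V (Pi.single σ (1 : ZMod 2)))
      rw [ih, map_zero, add_zero] at h3
      rw [h1, eq_sub_of_add_eq h2, map_sub, h3, sub_self]
  exact LinearMap.congr_fun h c

theorem boundary_mem_chainsOn {k : ℕ} {S : Set (Finset V)}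
    (hS : ∀ σ ∈ S, ∀ τ ⊆ σ, τ ∈ S) {c : Finset V → ZMod 2} (hc : c ∈ chainsOn (k + 1) S) :
    boundary V c ∈ chainsOn k S := by
  intro τ hτ
  obtain ⟨σ, hσ, v, hv, rfl⟩ := exists_of_boundary_ne_zero hτ
  refine ⟨hS σ (hc σ hσ).1 _ (Finset.erase_subset _ _), ?_⟩
  rw [Finset.card_erase_of_mem hv, (hc σ hσ).2]
  rfl

theorem cone_mem_chainsOn {k : ℕ} {S : Set (Finset V)} {u : V} {c : Finset V → ZMod 2}
    (h : ∀ σ, c σ ≠ 0 → insert u σ ∈ S ∧ σ.card = k + 1) : cone u c ∈ chainsOn (k + 1) S := by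
  intro τ hτ
  obtain ⟨σ, hσ, hu, rfl⟩ := exists_of_cone_ne_zero hτ
  exact ⟨(h σ hσ).1, by rw [Finset.card_insert_of_notMem hu, (h σ hσ).2]⟩

/-- A dominated vertex can be removed from a complex without affecting its homology. -/
theorem cyclesOn_le_of_dominated (k : ℕ) {S : Set (Finset V)} (hS : ∀ σ ∈ S, ∀ τ ⊆ σ, τ ∈ S)
    {u v : V} (huv : u ≠ v) (hdom : ∀ σ ∈ S, v ∈ σ → insert u σ ∈ S) :
    cyclesOn k S ≤ boundariesOn k S ⊔ cyclesOn k {σ ∈ S | v ∉ σ} := by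
  rintro c ⟨hc, hc0⟩
  replace hc0 : boundary V c = 0 := hc0
  -- `p` is the part of `c` that meets `v`. By domination its cone from `u` stays in `S`, and
  -- subtracting the boundary of that cone pushes `c` off `v`.
  let p : Finset V → ZMod 2 := fun σ => if v ∈ σ then c σ else 0
  have hp : cone u p ∈ chainsOn (k + 1) S := by
    refine cone_mem_chainsOn fun σ hσ => ?_
    simp only [p] at hσ
    split_ifs at hσ with hv
    · exact ⟨hdom σ (hc σ hσ).1 hv, (hc σ hσ).2⟩
    · exact absurd rfl hσ
  have hsub : c - boundary V (cone u p) ∈ chainsOn k S := sub_mem hc (boundary_mem_chainsOn hS hp)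
  refine Submodule.mem_sup.2 ⟨_, ⟨_, hp, rfl⟩, c - boundary V (cone u p),
    ⟨fun σ hσ => ⟨⟨(hsub σ hσ).1, fun hv => hσ ?_⟩, (hsub σ hσ).2⟩, ?_⟩, by abel⟩
  · have h1 : c - boundary V (cone u p) = (c - p) + cone u (boundary V p) := by
      rw [eq_sub_of_add_eq (boundary_cone_add u p)]
      abel
    have h2 : (c - p) σ = 0 := by simp [p, hv]
    rw [h1, Pi.add_apply, h2, zero_add]
    by_contra hne
    obtain ⟨τ, hτ, hu, rfl⟩ := exists_of_cone_ne_zero hne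
    have hvτ : v ∈ τ := (Finset.mem_insert.1 hv).resolve_left huv.symm
    -- As `c` is a cycle, the boundaries of `p` and `c - p` agree up to sign; but the simplices of
    -- `c - p` avoid `v`, hence so do their facets.
    have h3 : boundary V (c - p) τ ≠ 0 := by
      rw [map_sub, hc0, Pi.sub_apply, Pi.zero_apply, zero_sub, neg_ne_zero]
      exact hτ
    obtain ⟨ρ, hρ, x, hx, rfl⟩ := exists_of_boundary_ne_zero h3
    exact hρ (by simp [p, Finset.mem_of_mem_erase hvτ])
  · change boundary V (c - boundary V (cone u p)) = 0
    rw [map_sub, hc0, boundary_boundary, sub_zero]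

theorem cyclesOn_le_boundariesOn_of_cone (k : ℕ) {S : Set (Finset V)} {u : V}
    (hu : ∀ σ ∈ S, σ.Nonempty → insert u σ ∈ S) : cyclesOn k S ≤ boundariesOn k S := by
  rintro c ⟨hc, hc0⟩
  replace hc0 : boundary V c = 0 := hc0
  refine ⟨cone u c, cone_mem_chainsOn fun σ hσ => ⟨hu σ (hc σ hσ).1 ?_, (hc σ hσ).2⟩, ?_⟩
  · rw [← Finset.card_pos, (hc σ hσ).2]
    omega
  · have := boundary_cone_add u c
    rwa [hc0, map_zero, add_zero] at this

theorem boundariesOn_mono (k : ℕ) {S T : Set (Finset V)} (h : S ⊆ T) :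
    boundariesOn k S ≤ boundariesOn k T :=
  Submodule.map_mono fun _ hc σ hσ => ⟨h (hc σ hσ).1, (hc σ hσ).2⟩

end Cone

open FilteredComplex in
/-- The complexes of the doubled graph of a pair of equal weights are acyclic: the second copy of
the vertex `i` is dominated by the first one, once the second copies of the vertices after `i`
have been removed. -/
theorem rCrossBarcode_self (k : ℕ) {n : ℕ} (w : EdgeWeights n) : rCrossBarcode k w w = 0 := by
  refine barcode_eq_zero_of_cycles_le _ k fun α => ?_
  let K := vietorisRips (crossMatrix w w)
  -- Only the second copies of index below `m` are kept: `T n` is the whole complex, and `T 0`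
  -- involves first copies only, which are at mutual weight `0`.
  let T (m : ℕ) : Set (Finset (Fin n ⊕ Fin n)) :=
    {σ ∈ K.faces α | ∀ j : Fin n, Sum.inr j ∈ σ → (j : ℕ) < m}
  have hT : ∀ m, ∀ σ ∈ T m, ∀ τ ⊆ σ, τ ∈ T m := fun m σ hσ τ h =>
    ⟨K.down_closed α σ τ hσ.1 h, fun j hj => hσ.2 j (h hj)⟩
  have hnonneg : ∀ σ ∈ K.faces α, σ.Nonempty → (0 : EReal) ≤ α := by
    rintro σ hσ ⟨a | a, ha⟩
    · exact hσ _ ha _ ha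
    · simpa [crossMatrix, w.diag] using hσ _ ha _ ha
  have hinsert : ∀ m, ∀ i : Fin n, ∀ σ ∈ T m, σ.Nonempty →
      (∀ j, Sum.inr j ∈ σ → j ≤ i ∧ (w.weight j i : EReal) ≤ α) → insert (Sum.inl i) σ ∈ T m := by
    intro m i σ hσ hne hi
    have h0 := hnonneg σ hσ.1 hne
    refine ⟨fun a ha b hb => ?_, fun j hj => hσ.2 j ?_⟩
    · rcases Finset.mem_insert.1 ha with rfl | ha <;> rcases Finset.mem_insert.1 hb with rfl | hb
      · exact h0
      · rcases b with j | j
        · exact h0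
        · simp only [crossMatrix, if_pos (hi j hb).1, (hi j hb).2]
      · rcases a with j | j
        · exact h0
        · simp only [crossMatrix, if_pos (hi j ha).1, (hi j ha).2]
      · exact hσ.1 a ha b hb
    · simpa using hj
  have main : ∀ m, cyclesOn k (T m) ≤ boundariesOn k (K.faces α) := by
    intro m
    induction m with
    | zero =>
      intro c hc
      by_cases hc0 : c = 0
      · rw [hc0]
        exact zero_mem _
      obtain ⟨σ, hσ⟩ := Function.ne_iff.1 hc0
      obtain ⟨a, ha⟩ : σ.Nonempty := by
        rw [← Finset.card_pos, (hc.1 σ hσ).2]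
        omega
      rcases a with i | j
      · refine boundariesOn_mono k (fun σ hσ => hσ.1)
          (cyclesOn_le_boundariesOn_of_cone k (S := T 0) (u := Sum.inl i) (fun σ hσ hne => ?_) hc)
        exact hinsert 0 i σ hσ hne fun j hj => absurd (hσ.2 j hj) (Nat.not_lt_zero _)
      · exact absurd ((hc.1 σ hσ).1.2 j ha) (Nat.not_lt_zero _)
    | succ m ih =>
      by_cases hm : m < n
      · refine (cyclesOn_le_of_dominated k (hT (m + 1)) (u := Sum.inl ⟨m, hm⟩)
          (v := Sum.inr ⟨m, hm⟩) Sum.inl_ne_inr fun σ hσ hv => ?_).trans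
          (sup_le (boundariesOn_mono k fun σ hσ => hσ.1) (le_trans ?_ ih))
        -- Every remaining second copy `j` has `j ≤ m`, so its edge to the first copy of `m` is
        -- finite. Its weight equals that of the edge to the second copy of `m`, since the minimum
        -- of `w` with itself is `w`.
        · refine hinsert (m + 1) _ σ hσ ⟨_, hv⟩ fun j hj => ⟨Nat.lt_succ_iff.1 (hσ.2 j hj), ?_⟩
          simpa [crossMatrix] using hσ.1 _ hj _ hv
        · refine inf_le_inf_right _ fun c hc σ hσ => ⟨⟨(hc σ hσ).1.1.1, fun j hj => ?_⟩, (hc σ hσ).2⟩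
          refine lt_of_le_of_ne (Nat.lt_succ_iff.1 ((hc σ hσ).1.1.2 j hj)) fun h => (hc σ hσ).1.2 ?_
          rwa [← Fin.ext (a := j) (b := ⟨m, hm⟩) h]
      · refine le_trans ?_ ih
        refine inf_le_inf_right _ fun c hc σ hσ => ⟨⟨(hc σ hσ).1.1, fun j hj => ?_⟩, (hc σ hσ).2⟩
        have := j.2
        omega
  refine le_trans ?_ (main n)
  exact inf_le_inf_right _ fun c hc σ hσ => ⟨⟨(hc σ hσ).1, fun j _ => j.2⟩, (hc σ hσ).2⟩

/-- The empty barcode is that of `(w, w)`, so the norm is a distance to which stability applies with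
only the second weight changing. -/
theorem bottleneckNorm_rCrossBarcode_le_of_forall (k : ℕ) {n : ℕ} {w w' : EdgeWeights n} {C : ℝ}
    (hC : 0 ≤ C) (h : ∀ i j, |w.weight i j - w'.weight i j| ≤ C) :
    (rCrossBarcode k w w').bottleneckNorm ≤ ENNReal.ofReal C := by
  rw [Barcode.bottleneckNorm, ← rCrossBarcode_self k w]
  exact bottleneckDist_rCrossBarcode_le_of_forall k hC (fun i j => by simpa using hC) h

end

noncomputable section

/-! ### Measurability and integration over samples -/

/-- The edge weights obtained from a matrix by symmetrising it, taking absolute values and removing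
the diagonal. -/
def EdgeWeights.ofMatrix {n : ℕ} (a : Fin n → Fin n → ℝ) : EdgeWeights n where
  weight i j := if i = j then 0 else |a i j + a j i| / 2
  symm i j := by simp only [eq_comm (a := i), add_comm (a i j)]
  nonneg i j := by split_ifs <;> positivity
  diag i := if_pos rfl

theorem EdgeWeights.ofMatrix_weight {n : ℕ} (w : EdgeWeights n) : ofMatrix w.weight = w := by
  ext i j
  simp only [ofMatrix]
  split_ifs with h
  · rw [h, w.diag]
  · rw [w.symm j i, abs_of_nonneg (add_nonneg (w.nonneg i j) (w.nonneg i j))]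
    ring

theorem EdgeWeights.abs_ofMatrix_sub_le {n : ℕ} (a b : Fin n → Fin n → ℝ) (i j : Fin n) :
    |(ofMatrix a).weight i j - (ofMatrix b).weight i j| ≤ dist a b := by
  have h : ∀ i j, |a i j - b i j| ≤ dist a b := fun i j =>
    (dist_le_pi_dist (a i) (b i) j).trans (dist_le_pi_dist a b i)
  simp only [ofMatrix]
  split_ifs
  · simp
  · have h1 := abs_abs_sub_abs_le_abs_sub (a i j + a j i) (b i j + b j i)
    have h2 := abs_add_le (a i j - b i j) (a j i - b j i)
    rw [show a i j + a j i - (b i j + b j i) = a i j - b i j + (a j i - b j i) by ring] at h1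
    rw [← sub_div, abs_div, abs_two]
    linarith [h i j, h j i]

theorem bottleneckDist_ofMatrix_le (k : ℕ) {n : ℕ} (a b a' b' : Fin n → Fin n → ℝ) :
    (rCrossBarcode k (.ofMatrix a) (.ofMatrix b)).bottleneckDist
      (rCrossBarcode k (.ofMatrix a') (.ofMatrix b')) ≤ edist (a, b) (a', b') := by
  rw [edist_comm, edist_dist, Prod.dist_eq]
  exact bottleneckDist_rCrossBarcode_le_of_forall k (le_max_of_le_left dist_nonneg)
    (fun i j => (EdgeWeights.abs_ofMatrix_sub_le a' a i j).trans (le_max_left _ _))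
    (fun i j => (EdgeWeights.abs_ofMatrix_sub_le b' b i j).trans (le_max_right _ _))

theorem Barcode.continuous_bottleneckDist {α : Type*} [PseudoEMetricSpace α] {B C : α → Barcode}
    (hB : ∀ x y, (B x).bottleneckDist (B y) ≤ edist x y)
    (hC : ∀ x y, (C x).bottleneckDist (C y) ≤ edist x y) :
    Continuous fun x => (B x).bottleneckDist (C x) := by
  refine continuous_of_le_add_edist 2 (by simp) fun x y => ?_
  calc (B x).bottleneckDist (C x)
      ≤ (B x).bottleneckDist (B y) + ((B y).bottleneckDist (C y) + (C y).bottleneckDist (C x)) :=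
        (bottleneckDist_triangle _ _ _).trans
          (add_le_add_right (bottleneckDist_triangle _ _ _) _)
    _ ≤ edist x y + ((B y).bottleneckDist (C y) + edist x y) :=
        add_le_add (hB x y) (add_le_add_right ((hC y x).trans_eq (edist_comm y x)) _)
    _ = (B y).bottleneckDist (C y) + 2 * edist x y := by ring

/-- The retraction `EdgeWeights.ofMatrix` is 1-Lipschitz entrywise, so the distance extends to a
continuous function of four arbitrary matrices; composing it with the measurable weights gives the
claim. -/
theorem measurable_bottleneckDist_rCrossBarcode {Ω : Type*} [MeasurableSpace Ω] (k : ℕ) {n : ℕ}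
    {w w' v v' : Ω → EdgeWeights n} (hw : Measurable fun x => (w x).weight)
    (hw' : Measurable fun x => (w' x).weight) (hv : Measurable fun x => (v x).weight)
    (hv' : Measurable fun x => (v' x).weight) :
    Measurable fun x => (rCrossBarcode k (w x) (w' x)).bottleneckDist
      (rCrossBarcode k (v x) (v' x)) := by
  let M := Fin n → Fin n → ℝ
  have hcont : Continuous fun p : (M × M) × (M × M) =>
      (rCrossBarcode k (.ofMatrix p.1.1) (.ofMatrix p.1.2)).bottleneckDist
        (rCrossBarcode k (.ofMatrix p.2.1) (.ofMatrix p.2.2)) :=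
    Barcode.continuous_bottleneckDist
      (fun p q => (bottleneckDist_ofMatrix_le k _ _ _ _).trans (le_max_left _ _))
      (fun p q => (bottleneckDist_ofMatrix_le k _ _ _ _).trans (le_max_right _ _))
  have := hcont.measurable.comp ((hw.prodMk hw').prodMk (hv.prodMk hv'))
  simpa only [Function.comp_def, EdgeWeights.ofMatrix_weight] using this

theorem measurable_bottleneckNorm_rCrossBarcode {Ω : Type*} [MeasurableSpace Ω] (k : ℕ) {n : ℕ}
    {w w' : Ω → EdgeWeights n} (hw : Measurable fun x => (w x).weight)
    (hw' : Measurable fun x => (w' x).weight) :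
    Measurable fun x => (rCrossBarcode k (w x) (w' x)).bottleneckNorm := by
  have := measurable_bottleneckDist_rCrossBarcode k hw hw' hw hw
  simpa only [rCrossBarcode_self, Barcode.bottleneckNorm] using this

theorem measurable_sampleWeights {X : Type*} [MeasurableSpace X] {d : MetricSpace X}
    (hd : Measurable fun p : X × X => d.dist p.1 p.2) (n : ℕ) :
    Measurable fun x : Fin n → X => (sampleWeights d x).weight :=
  measurable_pi_lambda _ fun i => measurable_pi_lambda _ fun j =>
    show Measurable fun x : Fin n → X => d.dist (x i) (x j) from
      hd.comp (f := fun x : Fin n → X => (x i, x j))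
        ((measurable_pi_apply i).prodMk (measurable_pi_apply j))

/-- A function of a sample bounded by the largest difference between the distances of the points
has expectation at most `n` times the Gromov–Wasserstein distance. -/
theorem lintegral_pi_le_gromovWasserstein {X : Type u} [MeasurableSpace X] (μ : Measure X)
    [IsProbabilityMeasure μ] (d d' : MetricSpace X) (n : ℕ) (Φ : (Fin n → X) → ℝ≥0∞)
    (hΦ : ∀ x, ∀ C : ℝ, 0 ≤ C → (∀ i j, |(sampleWeights d x).weight i j -
      (sampleWeights d' x).weight i j| ≤ C) → Φ x ≤ ENNReal.ofReal C) :
    ∫⁻ x, Φ x ∂(Measure.pi fun _ : Fin n => μ) ≤ n * gromovWasserstein μ d d' := by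
  rcases Nat.eq_zero_or_pos n with rfl | hn
  -- For `n = 0` the right side is `0` even if the infimum is infinite, and division by `n` is not
  -- available.
  · have h0 : ∀ x, Φ x = 0 := fun x => by
      simpa using hΦ x 0 le_rfl fun i => i.elim0
    simp [h0]
  rw [mul_comm, ← ENNReal.div_le_iff_le_mul (Or.inl (by simpa using hn.ne')) (Or.inl (by simp))]
  refine le_sInf ?_
  rintro r ⟨Z, ρ, e, e', he, he', hmeas, rfl⟩
  refine ENNReal.div_le_of_le_mul' ?_
  let ψ : X → ℝ≥0∞ := fun x => ENNReal.ofReal (ρ.dist (e x) (e' x))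
  have hψ : AEMeasurable ψ μ := hmeas.ennreal_ofReal
  have hnn : ∀ x, 0 ≤ ρ.dist (e x) (e' x) := fun x =>
    @dist_nonneg Z ρ.toPseudoMetricSpace _ _
  have hle : ∀ x, Φ x ≤ ∑ i, ψ (x i) := by
    intro x
    rw [← ENNReal.ofReal_sum_of_nonneg fun i _ => hnn (x i)]
    refine hΦ x _ (Finset.sum_nonneg fun i _ => hnn (x i)) fun i j => ?_
    -- The two displacements are distinct terms of the sum only if `i ≠ j`; on the diagonal both
    -- weights vanish.
    by_cases hij : i = j
    · rw [hij, EdgeWeights.diag, EdgeWeights.diag, sub_self, abs_zero]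
      exact Finset.sum_nonneg fun i _ => hnn (x i)
    · have h1 : |d.dist (x i) (x j) - d'.dist (x i) (x j)| ≤
          ρ.dist (e (x i)) (e' (x i)) + ρ.dist (e (x j)) (e' (x j)) := by
        rw [← he, ← he']
        exact @dist_dist_dist_le Z ρ.toPseudoMetricSpace _ _ _ _
      refine h1.trans ?_
      rw [← Finset.sum_pair (f := fun i => ρ.dist (e (x i)) (e' (x i))) hij]
      exact Finset.sum_le_sum_of_subset_of_nonneg (Finset.subset_univ _) fun i _ _ => hnn (x i)
  have hmp : ∀ i : Fin n, MeasurePreserving (Function.eval i) (Measure.pi fun _ : Fin n => μ) μ :=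
    fun i => measurePreserving_eval (fun _ => μ) i
  calc ∫⁻ x, Φ x ∂(Measure.pi fun _ : Fin n => μ)
      ≤ ∫⁻ x, ∑ i, ψ (x i) ∂(Measure.pi fun _ : Fin n => μ) := lintegral_mono hle
    _ = ∑ i, ∫⁻ x, ψ (x i) ∂(Measure.pi fun _ : Fin n => μ) :=
        lintegral_finsetSum' _ fun i _ => hψ.comp_quasiMeasurePreserving
          (hmp i).quasiMeasurePreserving
    _ = ∑ _i : Fin n, ∫⁻ x, ψ x ∂μ := by
        refine Finset.sum_congr rfl fun i _ => ?_
        have h := (hmp i).map_eq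
        conv_rhs => rw [← h]
        rw [lintegral_map' (by rwa [h]) (measurable_pi_apply i).aemeasurable]
    _ = n * ∫⁻ x, ψ x ∂μ := by simp

end

theorem proposition2 (k n : ℕ) :
    -- (a)
    (∀ w w' v v' : EdgeWeights n,
      (rCrossBarcode k w w').bottleneckDist (rCrossBarcode k v v') ≤
        ENNReal.ofReal (max (⨆ i, ⨆ j, |v.weight i j - w.weight i j|)
          (⨆ i, ⨆ j, |v'.weight i j - w'.weight i j|))) ∧
    -- (b)
    (∀ w w' : EdgeWeights n,
      (rCrossBarcode k w w').bottleneckNorm ≤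
        ENNReal.ofReal (⨆ i, ⨆ j, |w.weight i j - w'.weight i j|)) ∧
    -- (c)
    (∀ (X : Type u) [MeasurableSpace X] (μ : Measure X) [IsProbabilityMeasure μ]
      (d d' d'' : MetricSpace X),
      Measurable (fun p : X × X => d.dist p.1 p.2) →
      Measurable (fun p : X × X => d'.dist p.1 p.2) →
      Measurable (fun p : X × X => d''.dist p.1 p.2) →
      Measurable (fun x : Fin n → X =>
        (rCrossBarcode k (sampleWeights d x) (sampleWeights d'' x)).bottleneckDist
          (rCrossBarcode k (sampleWeights d' x) (sampleWeights d'' x))) ∧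
      ∫⁻ x : Fin n → X,
        (rCrossBarcode k (sampleWeights d x) (sampleWeights d'' x)).bottleneckDist
          (rCrossBarcode k (sampleWeights d' x) (sampleWeights d'' x))
        ∂(Measure.pi fun _ => μ) ≤ n * gromovWasserstein μ d d') ∧
    -- (d)
    (∀ (X : Type u) [MeasurableSpace X] (μ : Measure X) [IsProbabilityMeasure μ]
      (d d' : MetricSpace X),
      Measurable (fun p : X × X => d.dist p.1 p.2) →
      Measurable (fun p : X × X => d'.dist p.1 p.2) →
      Measurable (fun x : Fin n → X =>
        (rCrossBarcode k (sampleWeights d x) (sampleWeights d' x)).bottleneckNorm) ∧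
      ∫⁻ x : Fin n → X,
        (rCrossBarcode k (sampleWeights d x) (sampleWeights d' x)).bottleneckNorm
        ∂(Measure.pi fun _ => μ) ≤ n * gromovWasserstein μ d d') := by
  refine ⟨bottleneckDist_rCrossBarcode_le k, fun w w' => ?_, ?_, ?_⟩
  · exact bottleneckNorm_rCrossBarcode_le_of_forall k (iSup_abs_sub_nonneg w.weight w'.weight)
      (abs_sub_le_iSup w.weight w'.weight)
  · intro X _ μ _ d d' d'' hd hd' hd''
    refine ⟨measurable_bottleneckDist_rCrossBarcode k (measurable_sampleWeights hd n)
      (measurable_sampleWeights hd'' n) (measurable_sampleWeights hd' n)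
      (measurable_sampleWeights hd'' n), lintegral_pi_le_gromovWasserstein μ d d' n _ ?_⟩
    intro x C hC h
    rw [Barcode.bottleneckDist_comm]
    exact bottleneckDist_rCrossBarcode_le_of_forall k hC h fun i j => by simpa using hC
  · intro X _ μ _ d d' hd hd'
    refine ⟨measurable_bottleneckNorm_rCrossBarcode k (measurable_sampleWeights hd n)
      (measurable_sampleWeights hd' n), lintegral_pi_le_gromovWasserstein μ d d' n _ ?_⟩
    exact fun x C hC h => bottleneckNorm_rCrossBarcode_le_of_forall k hC h
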